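/- **Setting.** Let $\mathbb H$ be a separable complex reproducing kernel Hilbert space of functions on a compact space $E$ with continuous kernel $R$. Fix a complete orthonormal system $\{e_j\}$ of $\mathbb H$, and call $x\in\mathbb H$ real if all $\langle x,e_j\rangle$ are real. Write $(x\otimes y)z=\langle z,y\rangle x$, and let $\|\cdot\|_{\rm tr}$, $\|\cdot\|_{\rm HS}$ be the trace and Hilbert–Schmidt norms. Let $\{X(t),t\in\mathbb R^d\}$ be a zero-mean stationary Gaussian process with values in the real elements of $\mathbb H$, with covariance operator $C(h)=\mathbb E[X(t+h)\otimes X(t)]$ and spectral density $$f(\theta)=\frac1{(2\pi)^d}\int_{\mathbb R^d}e^{\mathrm i h^\top\theta}C(h)\,dh .$$ **Covariance.** Assume $\int\|C(h)\|_{\rm tr}\,dh<\infty$ and, for some $0<\gamma\le 1$, $M<\infty$ and all small $\delta>0$, $$\int_{\mathbb R^d}\sup_{\|y-x\|\le\delta}\|C(y)-C(x)\|_{\rm tr}\,dx\le M\delta^\gamma .$$ **Kernel.** Let $K:\mathbb R^d\to[0,\infty)$ be Lipschitz continuous, with $S_K=\{K>0\}$ bounded, $\sup K=K(0)=1$, and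 $K$ differentiable with bounded gradient in a neighbourhood of $0$. **Sampling.** Let $\mathbb T_n\subset\mathbb R^d$ be finite sets of locations, $T_n$ the convex hull of $\mathbb T_n$, $V(t)=\{x\in T_n:\|x-t\|\le\|x-s\|\ \forall s\in\mathbb T_n\}$ the Voronoi cells and $\delta_n=\max_{t\in\mathbb T_n}\sup_{x\in V(t)}\|x-t\|$. Assume $\delta_n\to0$, $|T_n|\to\infty$ and $T_n/|T_n|^{1/d}\to T$ in the Hausdorff metric for some bounded convex set $T$ with non-empty interior ($|\cdot|$ is Lebesgue measure). **Estimator.** For bandwidths $\Delta_n$ put $$\hat f_n(\theta)=\frac1{(2\pi)^d}\sum_{t,s\in\mathbb T_n}e^{\mathrm i(t-s)^\top\theta}\,\frac{X(t)\otimes X(s)}{|T_n\cap(T_n-(t-s))|}\,K\Big(\frac{t-s}{\Delta_n}\Big)|V(t)|\,|V(s)| .$$ Let $D_n=\{u_{n,1},\dots,u_{n,m_n}\}\subset E$ be such that the matrix $(R(u_{n,i},u_{n,j}))_{i,j}$ is invertible, let $\Pi_n$ be the orthogonal projection of $\mathbb H$ onto $\mathrm{span}\{R(u,\cdot):u\in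 D_n\}$, let $\tilde f_n(\theta)=\Pi_n\hat f_n(\theta)\Pi_n$, and let $\tilde f$ (which depends on $n$) be the spectral density of the projected process $\Pi_nX$. **Theorem.** Suppose that $\Delta_n\to\infty$, $\Delta_n^d/|T_n|\to0$ and $\Delta_n S_K\subset T_n-T_n$ for all large $n$. Then $\tilde f(\theta)=\Pi_nf(\theta)\Pi_n$ for all $n$ and $\theta$, and for every bounded set $\Theta\subset\mathbb R^d$, uniformly in $\theta\in\Theta$, $$\Big(\mathbb E\big\|\tilde f_n(\theta)-\tilde f(\theta)\big\|_{\rm HS}^2\Big)^{1/2}=\mathcal O\Big(\delta_n^\gamma+B_1(\Delta_n,\theta)+B_2(\Delta_n,\theta)+\sqrt{\Delta_n^d/|T_n|}\Big)\qquad(n\to\infty),$$ where $$B_1(\Delta,\theta)=\Big\|\int_{\Delta S_K}e^{\mathrm i h^\top\theta}\big(1-K(h/\Delta)\big)C(h)\,dh\Big\|_{\rm HS},\qquad B_2(\Delta,\theta)=\Big\|\int_{\mathbb R^d\setminus\Delta S_K}e^{\mathrm i h^\top\theta}C(h)\,dh\Big\|_{\rm HS}.$$ In particular the supremum over $\theta\in\Theta$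 of the left-hand side is of the order of the supremum over $\theta\in\Theta$ of the right-hand side. -/

import Mathlib

open MeasureTheory ProbabilityTheory Filter Topology
open scoped ENNReal NNReal Pointwise

noncomputable section

namespace SpectralRKHS

/-! ### Operators on a complex Hilbert space -/

section Operators

variable {H : Type*} [NormedAddCommGroup H] [InnerProductSpace ℂ H] [CompleteSpace H]
  {ι : Type*}

/-- The trace norm `∑ⱼ ⟨(T* T)^(1/2) eⱼ, eⱼ⟩`, valued in `[0, ∞]`. The value is the same for every
complete orthonormal system `b`; `T` is trace class iff it is finite. -/
def traceNorm (b : HilbertBasis ι ℂ H) (T : H →L[ℂ] H) : ℝ≥0∞ :=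
  ∑' j, ENNReal.ofReal (inner ℂ (CFC.abs T (b j)) (b j)).re

/-- The Hilbert-Schmidt norm `(∑ⱼ ‖T eⱼ‖²)^(1/2)`, valued in `[0, ∞]`. The value is the same for
every complete orthonormal system `b`. -/
def hsNorm (b : HilbertBasis ι ℂ H) (T : H →L[ℂ] H) : ℝ≥0∞ :=
  (∑' j, ‖T (b j)‖ₑ ^ 2) ^ (1 / 2 : ℝ)

/-- The compression `Q T Q`. -/
def compress (Q T : H →L[ℂ] H) : H →L[ℂ] H := Q ∘L T ∘L Q

/-- `x` is real with respect to the complete orthonormal system `b`: its coordinates are real,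
i.e. `x` is equal to its complex conjugate `∑ⱼ conj ⟨x, eⱼ⟩ eⱼ`. -/
def IsRealVector (b : HilbertBasis ι ℂ H) (x : H) : Prop :=
  ∀ j, (inner ℂ (b j) x).im = 0

end Operators

/-! ### Stationary processes, covariance and spectral density -/

section Processes

variable {d : ℕ} {H : Type*} [NormedAddCommGroup H] [InnerProductSpace ℂ H] [CompleteSpace H]
  {ι : Type*} {Ω : Type*} [MeasurableSpace Ω]

/-- The covariance operator `C(t, s) = E[X(t) ⊗ X(s)]`, where `(x ⊗ y) z = ⟨z, y⟩ x` (linear in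
`z`). -/
def covOp (P : Measure Ω) (X : EuclideanSpace ℝ (Fin d) → Ω → H)
    (t s : EuclideanSpace ℝ (Fin d)) : H →L[ℂ] H :=
  ∫ ω, InnerProductSpace.rankOne ℂ (X t ω) (X s ω) ∂P

/-- The stationary covariance operator `C(h) = C(h, 0)`. -/
def autocov (P : Measure Ω) (X : EuclideanSpace ℝ (Fin d) → Ω → H)
    (h : EuclideanSpace ℝ (Fin d)) : H →L[ℂ] H :=
  covOp P X h 0

/-- `X` is a zero-mean stationary Gaussian process, real with respect to `b`. As `X` is real, its
pseudo-covariance is its covariance. -/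
structure IsStationaryGaussian [MeasurableSpace H] (P : Measure Ω) (b : HilbertBasis ι ℂ H)
    (X : EuclideanSpace ℝ (Fin d) → Ω → H) : Prop where
  gaussian : IsGaussianProcess X P
  real : ∀ t, ∀ᵐ ω ∂P, IsRealVector b (X t ω)
  zero_mean : ∀ t, ∫ ω, X t ω ∂P = 0
  stationary : ∀ t h, covOp P X (t + h) t = autocov P X h

/-- The character `exp(i hᵀθ)`. -/
def character (θ h : EuclideanSpace ℝ (Fin d)) : ℂ :=
  Complex.exp (Complex.I * ((inner ℝ h θ : ℝ) : ℂ))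

/-- The spectral density `(2π)⁻ᵈ ∫ exp(i hᵀθ) C(h) dh` attached to a covariance function. -/
def spectralDensity (C : EuclideanSpace ℝ (Fin d) → H →L[ℂ] H)
    (θ : EuclideanSpace ℝ (Fin d)) : H →L[ℂ] H :=
  (((2 * Real.pi) ^ d)⁻¹ : ℂ) • ∫ h, character θ h • C h

/-- The oscillation `sup_{‖x - y‖ ≤ δ} ‖C(y) - C(x)‖_tr`. -/
def oscillation (b : HilbertBasis ι ℂ H) (C : EuclideanSpace ℝ (Fin d) → H →L[ℂ] H) (δ : ℝ)
    (x : EuclideanSpace ℝ (Fin d)) : ℝ≥0∞ :=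
  ⨆ y ∈ Metric.closedBall x δ, traceNorm b (C y - C x)

/-- The covariance is integrable and `L¹`-`γ`-Hölder in trace norm. The Hölder bound is asked at
all small scales. -/
structure CovarianceRegular (b : HilbertBasis ι ℂ H) (C : EuclideanSpace ℝ (Fin d) → H →L[ℂ] H)
    (γ : ℝ) : Prop where
  integrable : ∫⁻ h, traceNorm b (C h) < ∞
  holder : 0 < γ ∧ γ ≤ 1 ∧ ∃ M : ℝ, ∃ δ₀ : ℝ, 0 < δ₀ ∧ ∀ δ : ℝ, 0 < δ → δ ≤ δ₀ →
    AEMeasurable (oscillation b C δ) volume ∧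
      ∫⁻ x, oscillation b C δ x ≤ ENNReal.ofReal (M * δ ^ γ)

end Processes

/-! ### Sampling design -/

section Sampling

variable {d : ℕ}

/-- The sampling region: the convex hull (closed, the set being finite) of the locations. -/
def region (S : Finset (EuclideanSpace ℝ (Fin d))) : Set (EuclideanSpace ℝ (Fin d)) :=
  convexHull ℝ (S : Set (EuclideanSpace ℝ (Fin d)))

/-- The Voronoi cell of `t` in the sampling region. -/
def cell (S : Finset (EuclideanSpace ℝ (Fin d))) (t : EuclideanSpace ℝ (Fin d)) :
    Set (EuclideanSpace ℝ (Fin d)) :=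
  {x ∈ region S | ∀ s ∈ S, dist x t ≤ dist x s}

/-- The diameter `max_t sup_{x ∈ V(t)} ‖x - t‖` of the Voronoi tessellation. -/
def meshSize (S : Finset (EuclideanSpace ℝ (Fin d))) : ℝ :=
  sSup {r : ℝ | ∃ t ∈ S, ∃ x ∈ cell S t, r = dist x t}

/-- The mixed-domain sampling framework: the mesh size tends to `0`, the volume of the sampling
region tends to infinity, and the sampling region, normalized to volume one, tends in the Hausdorff
metric to a bounded convex set with non-empty interior. -/
structure SamplingDesign (S : ℕ → Finset (EuclideanSpace ℝ (Fin d))) : Prop where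
  mesh : Tendsto (fun n => meshSize (S n)) atTop (𝓝 0)
  volume_tendsto : Tendsto (fun n => volume.real (region (S n))) atTop atTop
  shape : ∃ T : Set (EuclideanSpace ℝ (Fin d)), Bornology.IsBounded T ∧ Convex ℝ T ∧
    (interior T).Nonempty ∧
    Tendsto (fun n => Metric.hausdorffDist
      (((volume.real (region (S n))) ^ (1 / d : ℝ))⁻¹ • region (S n)) T) atTop (𝓝 0)

/-- The set `S_K` where the kernel is positive. -/
def kernelSupport (K : EuclideanSpace ℝ (Fin d) → ℝ) : Set (EuclideanSpace ℝ (Fin d)) :=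
  {u | 0 < K u}

/-- The conditions on the smoothing kernel. -/
structure KernelRegular (K : EuclideanSpace ℝ (Fin d) → ℝ) : Prop where
  nonneg : ∀ u, 0 ≤ K u
  continuous : Continuous K
  bounded_support : Bornology.IsBounded (kernelSupport K)
  le_one : ∀ u, K u ≤ 1
  at_zero : K 0 = 1
  differentiable : ∃ ε : ℝ, 0 < ε ∧ ∃ L : ℝ, ∀ u ∈ Metric.ball 0 ε,
    DifferentiableAt ℝ K u ∧ ‖gradient K u‖ ≤ L
  lipschitz : ∃ L : ℝ≥0, LipschitzWith L K

variable {H : Type*} [NormedAddCommGroup H] [InnerProductSpace ℂ H] [CompleteSpace H]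
  {ι : Type*} {Ω : Type*} [MeasurableSpace Ω]

/-- The lag-window estimator
`(2π)⁻ᵈ ∑ₜ ∑ₛ exp(i (t-s)ᵀθ) X(t) ⊗ X(s) / |T ∩ (T - (t-s))| · K((t-s)/Δ) · |V(t)| |V(s)|`. -/
def estimator (X : EuclideanSpace ℝ (Fin d) → Ω → H) (S : Finset (EuclideanSpace ℝ (Fin d)))
    (K : EuclideanSpace ℝ (Fin d) → ℝ) (Δ : ℝ) (θ : EuclideanSpace ℝ (Fin d)) (ω : Ω) :
    H →L[ℂ] H :=
  (((2 * Real.pi) ^ d)⁻¹ : ℂ) • ∑ t ∈ S, ∑ s ∈ S,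
    (character θ (t - s) *
      ((K (Δ⁻¹ • (t - s)) * volume.real (cell S t) * volume.real (cell S s) /
        volume.real (region S ∩ (-(t - s) +ᵥ region S)) : ℝ) : ℂ)) •
      InnerProductSpace.rankOne ℂ (X t ω) (X s ω)

/-- `B₁`: the Hilbert-Schmidt norm of `∫_{h ∈ Δ S_K} exp(i hᵀθ) (1 - K(h/Δ)) C(h) dh`. -/
def biasB1 (b : HilbertBasis ι ℂ H) (C : EuclideanSpace ℝ (Fin d) → H →L[ℂ] H)
    (K : EuclideanSpace ℝ (Fin d) → ℝ) (Δ : ℝ) (θ : EuclideanSpace ℝ (Fin d)) : ℝ :=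
  (hsNorm b (∫ h in Δ • kernelSupport K,
    (character θ h * ((1 - K (Δ⁻¹ • h) : ℝ) : ℂ)) • C h)).toReal

/-- `B₂`: the Hilbert-Schmidt norm of `∫_{h ∉ Δ S_K} exp(i hᵀθ) C(h) dh`. -/
def biasB2 (b : HilbertBasis ι ℂ H) (C : EuclideanSpace ℝ (Fin d) → H →L[ℂ] H)
    (K : EuclideanSpace ℝ (Fin d) → ℝ) (Δ : ℝ) (θ : EuclideanSpace ℝ (Fin d)) : ℝ :=
  (hsNorm b (∫ h in (Δ • kernelSupport K)ᶜ, character θ h • C h)).toReal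

/-- The root mean square `(E ‖A‖²_HS)^(1/2)` of a random operator, valued in `[0, ∞]`. -/
def rootMeanSquare (P : Measure Ω) (b : HilbertBasis ι ℂ H) (A : Ω → H →L[ℂ] H) : ℝ≥0∞ :=
  (∫⁻ ω, hsNorm b (A ω) ^ 2 ∂P) ^ (1 / 2 : ℝ)

end Sampling

/-! ### Projection on the span of finitely many kernel functions -/

section Projection

variable {E : Type*} (H : Type*) [NormedAddCommGroup H] [InnerProductSpace ℂ H] [CompleteSpace H]
  [RKHS ℂ H E ℂ]

/-- The element `R(u, ·)` of `H` that represents the evaluation at `u`. -/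
def kernelSection (u : E) : H := RKHS.kerFun H u 1

/-- The reproducing kernel `R(u, v)`. -/
def reproducingKernel (u v : E) : ℂ := kernelSection H u v

/-- The matrix `(R(uᵢ, uⱼ))ᵢⱼ`. -/
def kernelMatrix {m : ℕ} (u : Fin m → E) : Matrix (Fin m) (Fin m) ℂ :=
  Matrix.of fun i j => reproducingKernel H (u i) (u j)

/-- The span of the functions `R(uⱼ, ·)`. -/
def observationSpace {m : ℕ} (u : Fin m → E) : Submodule ℂ H :=
  Submodule.span ℂ (Set.range fun j => kernelSection H (u j))

instance observationSpace_finiteDimensional {m : ℕ} (u : Fin m → E) :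
    FiniteDimensional ℂ (observationSpace H u) :=
  FiniteDimensional.span_of_finite ℂ (Set.finite_range _)

/-- The orthogonal projection of `H` onto the span of the functions `R(uⱼ, ·)`. -/
def observationProjection {m : ℕ} (u : Fin m → E) : H →L[ℂ] H :=
  (observationSpace H u).starProjection

end Projection

end SpectralRKHS

end

open SpectralRKHS

set_option linter.unusedSectionVars false

namespace SpectralRKHS

/-! ### Hilbert–Schmidt and trace norms, valued in `[0, ∞]` -/

section Operators

variable {H : Type*} [NormedAddCommGroup H] [InnerProductSpace ℂ H] [CompleteSpace H]
  {ι : Type*}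

/-! Up to the factor $(2\pi)^{-d}$, the error $\hat f_n-f$ is a centred quadratic form in $X$ plus
the deterministic difference between the mean of the estimator and $\int e^{ih^\top\theta}C(h)\,dh$
(`estimator_sub_spectralDensity`). Compression by an orthogonal projection contracts the
Hilbert–Schmidt norm and commutes with the integrals defining covariance and spectral density, so
both parts can be bounded for $X$ itself, with constants that do not depend on the projection.

Variance. Isserlis' formula leaves two pairings of covariances. Summed over the coordinates, one
factors into two diagonal sums of $C$ and the other is bounded by two Hilbert–Schmidt norms; all
four are at most trace norms (`lintegral_hsNorm_sq_le`). In the resulting sum over two pairs of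
locations, one weight is bounded by its maximum, of order $1/|T_n|$, and sums over Voronoi cells of
the covariance norms are bounded by integrals. The other weight, localized to lags of order
$\Delta_n$, sums to order $\Delta_n^d$ (`variance_le`).

Bias. The mean is a Riemann sum over pairs of Voronoi cells for
$\int_{T_n}\int_{T_n}G(x-y)\,dx\,dy=\int|T_n\cap(T_n-h)|\,G(h)\,dh$, and the overlap volume cancels
the denominator of the estimator. The discretization error comes from the oscillation of $C$, of
order $\delta_n^\gamma$, and from the Lipschitz constant of the weight, of order
$\delta_n\le\delta_n^\gamma$ (`hsNorm_discretization_le`). What remains is exactly the pair of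
integrals in $B_1$ and $B_2$ (`hsNorm_smoothing_le`).

Geometry. Hausdorff convergence of the rescaled regions puts a ball of radius of order $|T_n|^{1/d}$
inside $T_n$. Since $\Delta_n^d/|T_n|\to0$, the lags in the window are small against this radius, so
the overlap is at least $2^{-d}|T_n|$ and varies in a Lipschitz way. -/

/-- Orthonormal vectors lie at distance $\sqrt2$, so the balls of radius $1/2$ are disjoint.
Countability is what permits exchanging coordinate sums with expectations. -/
theorem countable_of_hilbertBasis [TopologicalSpace.SeparableSpace H] (b : HilbertBasis ι ℂ H) :
    Countable ι := by
  refine Pairwise.countable_of_isOpen_disjoint (s := fun i => Metric.ball (b i) (1 / 2)) ?_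
    (fun i => Metric.isOpen_ball) (fun i => ⟨b i, Metric.mem_ball_self (by norm_num)⟩)
  intro i j hij
  apply Metric.ball_disjoint_ball
  have h1 : ‖b i - b j‖ ^ 2 = 2 := by
    rw [@norm_sub_sq ℂ, b.orthonormal.2 hij, b.orthonormal.1 i, b.orthonormal.1 j]
    norm_num
  rw [dist_eq_norm]
  nlinarith [norm_nonneg (b i - b j)]

theorem tsum_enorm_inner_sq (b : HilbertBasis ι ℂ H) (x : H) :
    ∑' j, ‖inner ℂ (b j) x‖ₑ ^ 2 = ‖x‖ₑ ^ 2 := by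
  have h := b.hasSum_inner_mul_inner x x
  have h2 : HasSum (fun j => ‖inner ℂ (b j) x‖ ^ 2) (‖x‖ ^ 2) := by
    rw [inner_self_eq_norm_sq_to_K] at h
    have h3 : ∀ j, inner ℂ x (b j) * inner ℂ (b j) x = ((‖inner ℂ (b j) x‖ ^ 2 : ℝ) : ℂ) := by
      intro j
      rw [← inner_conj_symm x (b j), ← Complex.normSq_eq_conj_mul_self, Complex.normSq_eq_norm_sq]
    simp_rw [h3] at h
    refine Complex.hasSum_ofReal.1 ?_
    rw [Complex.ofReal_pow]
    exact h
  have h4 : ∀ j, ‖inner ℂ (b j) x‖ₑ ^ 2 = ENNReal.ofReal (‖inner ℂ (b j) x‖ ^ 2) := by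
    intro j
    rw [ENNReal.ofReal_pow (norm_nonneg _), ofReal_norm]
  simp_rw [h4]
  rw [← ENNReal.ofReal_tsum_of_nonneg (fun _ => by positivity) h2.summable, h2.tsum_eq,
    ENNReal.ofReal_pow (norm_nonneg _), ofReal_norm]

theorem le_of_sq_le_sq_ennreal {x y : ℝ≥0∞} (h : x ^ 2 ≤ y ^ 2) : x ≤ y :=
  (ENNReal.pow_le_pow_left_iff two_ne_zero).1 h

theorem hsNorm_sq (b : HilbertBasis ι ℂ H) (T : H →L[ℂ] H) :
    hsNorm b T ^ 2 = ∑' j, ‖T (b j)‖ₑ ^ 2 := by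
  rw [hsNorm, ← ENNReal.rpow_natCast, ← ENNReal.rpow_mul]
  norm_num

theorem hsNorm_sq_eq_tsum_inner (b : HilbertBasis ι ℂ H) (T : H →L[ℂ] H) :
    hsNorm b T ^ 2 = ∑' j, ∑' k, ‖inner ℂ (b k) (T (b j))‖ₑ ^ 2 := by
  simp_rw [hsNorm_sq, tsum_enorm_inner_sq]

theorem hsNorm_adjoint (b : HilbertBasis ι ℂ H) (T : H →L[ℂ] H) :
    hsNorm b (ContinuousLinearMap.adjoint T) = hsNorm b T := by
  have h : hsNorm b (ContinuousLinearMap.adjoint T) ^ 2 = hsNorm b T ^ 2 := by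
    rw [hsNorm_sq_eq_tsum_inner, hsNorm_sq_eq_tsum_inner, ENNReal.tsum_comm]
    refine tsum_congr fun j => tsum_congr fun k => ?_
    rw [ContinuousLinearMap.adjoint_inner_right, ← inner_conj_symm, RCLike.enorm_conj]
  exact le_antisymm (le_of_sq_le_sq_ennreal h.le) (le_of_sq_le_sq_ennreal h.ge)

theorem hsNorm_comp_le_left (b : HilbertBasis ι ℂ H) (A T : H →L[ℂ] H) :
    hsNorm b (A ∘L T) ≤ ‖A‖ₑ * hsNorm b T := by
  apply le_of_sq_le_sq_ennreal
  rw [mul_pow, hsNorm_sq, hsNorm_sq, ← ENNReal.tsum_mul_left]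
  refine ENNReal.tsum_le_tsum fun j => ?_
  rw [← mul_pow]
  gcongr
  exact A.le_opENorm _

theorem hsNorm_comp_le_right (b : HilbertBasis ι ℂ H) (A T : H →L[ℂ] H) :
    hsNorm b (T ∘L A) ≤ hsNorm b T * ‖A‖ₑ := by
  rw [← hsNorm_adjoint, ContinuousLinearMap.adjoint_comp, ← hsNorm_adjoint b T, mul_comm]
  refine (hsNorm_comp_le_left b _ _).trans_eq ?_
  congr 1
  rw [← ofReal_norm, ← ofReal_norm, LinearIsometryEquiv.norm_map]

theorem hsNorm_compress_le (b : HilbertBasis ι ℂ H) {Q : H →L[ℂ] H} (hQ : ‖Q‖ ≤ 1)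
    (T : H →L[ℂ] H) : hsNorm b (compress Q T) ≤ hsNorm b T := by
  have hQ' : ‖Q‖ₑ ≤ 1 := by
    rw [← ofReal_norm]; exact ENNReal.ofReal_le_one.2 hQ
  calc hsNorm b (compress Q T) ≤ ‖Q‖ₑ * hsNorm b (T ∘L Q) := hsNorm_comp_le_left b _ _
    _ ≤ 1 * (hsNorm b T * 1) := by
        gcongr
        exact (hsNorm_comp_le_right b _ _).trans (by gcongr)
    _ = hsNorm b T := by simp

theorem enorm_inner_le (x y : H) : ‖inner ℂ x y‖ₑ ≤ ‖x‖ₑ * ‖y‖ₑ := by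
  rw [← ofReal_norm, ← ofReal_norm, ← ofReal_norm, ← ENNReal.ofReal_mul (norm_nonneg _)]
  exact ENNReal.ofReal_le_ofReal (norm_inner_le_norm x y)

/-- Parseval for $Tx$, moving $T$ to the basis vectors and applying Cauchy–Schwarz in each
coordinate, bounds $\|Tx\|$ by the Hilbert–Schmidt norm of the adjoint. -/
theorem enorm_le_hsNorm (b : HilbertBasis ι ℂ H) (T : H →L[ℂ] H) : ‖T‖ₑ ≤ hsNorm b T := by
  rw [← hsNorm_adjoint]
  refine ContinuousLinearMap.opENorm_le_bound _ fun x => ?_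
  apply le_of_sq_le_sq_ennreal
  rw [mul_pow, hsNorm_sq, ← tsum_enorm_inner_sq b, ← ENNReal.tsum_mul_right]
  refine ENNReal.tsum_le_tsum fun j => ?_
  rw [← mul_pow, ← ContinuousLinearMap.adjoint_inner_left]
  gcongr
  exact enorm_inner_le _ _

/-- The finite-dimensional truncations `T ↦ (T eⱼ)_{j ∈ J}`. -/
noncomputable def hsTruncation (b : HilbertBasis ι ℂ H) (J : Finset ι) :
    (H →L[ℂ] H) →L[ℂ] PiLp 2 (fun _ : J => H) :=
  (PiLp.continuousLinearEquiv 2 ℂ (fun _ : J => H)).symm.toContinuousLinearMap ∘L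
    ContinuousLinearMap.pi fun j : J => ContinuousLinearMap.apply ℂ H (b j)

theorem enorm_hsTruncation_sq (b : HilbertBasis ι ℂ H) (J : Finset ι) (T : H →L[ℂ] H) :
    ‖hsTruncation b J T‖ₑ ^ 2 = ∑ j ∈ J, ‖T (b j)‖ₑ ^ 2 := by
  rw [← ofReal_norm, ← ENNReal.ofReal_pow (norm_nonneg _), PiLp.norm_sq_eq_of_L2,
    ENNReal.ofReal_sum_of_nonneg (fun _ _ => by positivity), ← Finset.sum_coe_sort J]
  refine Finset.sum_congr rfl fun j _ => ?_
  rw [ENNReal.ofReal_pow (norm_nonneg _), ofReal_norm]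
  rfl

/-- The Hilbert–Schmidt norm is a supremum of norms of continuous linear images. The triangle
inequality and the bound for Bochner integrals are inherited from these, without a finiteness
assumption. -/
theorem hsNorm_le_iff (b : HilbertBasis ι ℂ H) (T : H →L[ℂ] H) (c : ℝ≥0∞) :
    hsNorm b T ≤ c ↔ ∀ J, ‖hsTruncation b J T‖ₑ ≤ c := by
  have h : ∀ x y : ℝ≥0∞, x ≤ y ↔ x ^ 2 ≤ y ^ 2 :=
    fun x y => (ENNReal.pow_le_pow_left_iff two_ne_zero).symm
  rw [h, hsNorm_sq, ENNReal.tsum_eq_iSup_sum, iSup_le_iff]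
  refine forall_congr' fun J => ?_
  rw [h ‖_‖ₑ, enorm_hsTruncation_sq]

theorem enorm_hsTruncation_le (b : HilbertBasis ι ℂ H) (J : Finset ι) (T : H →L[ℂ] H) :
    ‖hsTruncation b J T‖ₑ ≤ hsNorm b T := (hsNorm_le_iff b T _).1 le_rfl J

theorem hsNorm_zero (b : HilbertBasis ι ℂ H) : hsNorm b 0 = 0 := by
  simp [hsNorm]

theorem hsNorm_add_le (b : HilbertBasis ι ℂ H) (S T : H →L[ℂ] H) :
    hsNorm b (S + T) ≤ hsNorm b S + hsNorm b T := by
  rw [hsNorm_le_iff]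
  intro J
  rw [map_add]
  exact (enorm_add_le _ _).trans
    (add_le_add (enorm_hsTruncation_le b J S) (enorm_hsTruncation_le b J T))

theorem hsNorm_smul (b : HilbertBasis ι ℂ H) (a : ℂ) (T : H →L[ℂ] H) :
    hsNorm b (a • T) = ‖a‖ₑ * hsNorm b T := by
  have h : hsNorm b (a • T) ^ 2 = (‖a‖ₑ * hsNorm b T) ^ 2 := by
    rw [mul_pow, hsNorm_sq, hsNorm_sq, ← ENNReal.tsum_mul_left]
    simp [enorm_smul, mul_pow]
  exact le_antisymm (le_of_sq_le_sq_ennreal h.le) (le_of_sq_le_sq_ennreal h.ge)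

theorem hsNorm_neg (b : HilbertBasis ι ℂ H) (T : H →L[ℂ] H) : hsNorm b (-T) = hsNorm b T := by
  simp [hsNorm]

theorem hsNorm_sum_le {κ : Type*} (b : HilbertBasis ι ℂ H) (s : Finset κ) (T : κ → H →L[ℂ] H) :
    hsNorm b (∑ i ∈ s, T i) ≤ ∑ i ∈ s, hsNorm b (T i) := by
  classical
  induction s using Finset.induction_on with
  | empty => simp [hsNorm_zero]
  | insert i s hi ih =>
    rw [Finset.sum_insert hi, Finset.sum_insert hi]
    exact (hsNorm_add_le b _ _).trans (by gcongr)

theorem hsNorm_integral_le {α : Type*} [MeasurableSpace α] (b : HilbertBasis ι ℂ H)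
    (μ : Measure α) (F : α → H →L[ℂ] H) :
    hsNorm b (∫ a, F a ∂μ) ≤ ∫⁻ a, hsNorm b (F a) ∂μ := by
  by_cases hF : Integrable F μ
  · rw [hsNorm_le_iff]
    intro J
    rw [← ContinuousLinearMap.integral_comp_comm _ hF]
    exact (enorm_integral_le_lintegral_enorm _).trans
      (lintegral_mono fun a => enorm_hsTruncation_le b J (F a))
  -- A non-integrable function has integral `0` by convention, so the bound holds trivially.
  · rw [integral_undef hF, hsNorm_zero]
    exact bot_le

/-- The `ℓ¹` norm of the diagonal `(⟨eⱼ, T eⱼ⟩)ⱼ`. -/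
noncomputable def diagNorm (b : HilbertBasis ι ℂ H) (T : H →L[ℂ] H) : ℝ≥0∞ :=
  ∑' j, ‖inner ℂ (b j) (T (b j))‖ₑ

theorem diagNorm_add_le (b : HilbertBasis ι ℂ H) (S T : H →L[ℂ] H) :
    diagNorm b (S + T) ≤ diagNorm b S + diagNorm b T := by
  rw [diagNorm, diagNorm, diagNorm, ← ENNReal.tsum_add]
  refine ENNReal.tsum_le_tsum fun j => ?_
  rw [add_apply, inner_add_right]
  exact enorm_add_le _ _

/-- The absolute value has a positive square root `B` that computes the trace norm. -/
theorem exists_sqrt_abs (b : HilbertBasis ι ℂ H) (T : H →L[ℂ] H) :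
    ∃ A B : H →L[ℂ] H, A.IsPositive ∧ B.IsPositive ∧ B ∘L B = A ∧ (∀ x, ‖T x‖ = ‖A x‖) ∧
      traceNorm b T = hsNorm b B ^ 2 := by
  have hA : (0 : H →L[ℂ] H) ≤ CFC.abs T := CFC.abs_nonneg T
  have hB : (0 : H →L[ℂ] H) ≤ CFC.sqrt (CFC.abs T) := CFC.sqrt_nonneg _
  have hBB : CFC.sqrt (CFC.abs T) * CFC.sqrt (CFC.abs T) = CFC.abs T :=
    CFC.sqrt_mul_sqrt_self _ hA
  have hAp := (ContinuousLinearMap.nonneg_iff_isPositive _).1 hA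
  have hBp := (ContinuousLinearMap.nonneg_iff_isPositive _).1 hB
  refine ⟨CFC.abs T, CFC.sqrt (CFC.abs T), hAp, hBp, hBB, fun x => ?_, ?_⟩
  · have h1 : CFC.abs T * CFC.abs T = star T * T := CFC.abs_mul_abs T
    have h2 : inner ℂ (T x) (T x) = inner ℂ (CFC.abs T x) (CFC.abs T x) := by
      rw [hAp.inner_left_eq_inner_right, ← mul_apply_eq_comp, h1,
        mul_apply_eq_comp, ContinuousLinearMap.star_eq_adjoint,
        ContinuousLinearMap.adjoint_inner_right]
    rw [inner_self_eq_norm_sq_to_K, inner_self_eq_norm_sq_to_K] at h2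
    have h3 : ‖T x‖ ^ 2 = ‖CFC.abs T x‖ ^ 2 := by exact_mod_cast h2
    exact (sq_eq_sq₀ (norm_nonneg _) (norm_nonneg _)).1 h3
  · rw [hsNorm_sq, traceNorm]
    refine tsum_congr fun j => ?_
    have h1 : inner ℂ (CFC.abs T (b j)) (b j) =
        inner ℂ (CFC.sqrt (CFC.abs T) (b j)) (CFC.sqrt (CFC.abs T) (b j)) := by
      conv_lhs => rw [← hBB]
      rw [mul_apply_eq_comp, hBp.inner_left_eq_inner_right]
    rw [h1, inner_self_eq_norm_sq_to_K, ← ofReal_norm,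
      ← ENNReal.ofReal_pow (norm_nonneg _)]
    congr 1
    norm_cast

theorem hsNorm_congr_norm (b : HilbertBasis ι ℂ H) {S T : H →L[ℂ] H} (h : ∀ x, ‖S x‖ = ‖T x‖) :
    hsNorm b S = hsNorm b T := by
  have h' : ∀ x, ‖S x‖ₑ = ‖T x‖ₑ := fun x => by
    rw [← ofReal_norm, ← ofReal_norm, h]
  simp [hsNorm, h']

/-- With $|T|=B^2$ one has $\|T\|_{HS}=\|B^2\|_{HS}\le\|B\|\,\|B\|_{HS}\le\|B\|_{HS}^2$, and the
last quantity is the trace norm. -/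
theorem hsNorm_le_traceNorm (b : HilbertBasis ι ℂ H) (T : H →L[ℂ] H) :
    hsNorm b T ≤ traceNorm b T := by
  obtain ⟨A, B, -, -, hBB, hTA, htr⟩ := exists_sqrt_abs b T
  rw [hsNorm_congr_norm b hTA, htr, ← hBB, sq]
  exact (hsNorm_comp_le_left b B B).trans (by gcongr; exact enorm_le_hsNorm b B)

theorem tsum_mul_le_sqrt {κ : Type*} (f g : κ → ℝ≥0∞) :
    ∑' i, f i * g i ≤ (∑' i, f i ^ 2) ^ (1 / 2 : ℝ) * (∑' i, g i ^ 2) ^ (1 / 2 : ℝ) := by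
  rw [ENNReal.tsum_eq_iSup_sum, iSup_le_iff]
  intro J
  refine (ENNReal.inner_le_Lp_mul_Lq J f g Real.HolderConjugate.two_two).trans ?_
  gcongr
  · simpa using ENNReal.sum_le_tsum (f := fun i => f i ^ 2) J
  · simpa using ENNReal.sum_le_tsum (f := fun i => g i ^ 2) J

theorem diagNorm_comp_le (b : HilbertBasis ι ℂ H) (S T : H →L[ℂ] H) :
    diagNorm b (S ∘L T) ≤ hsNorm b S * hsNorm b T := by
  calc diagNorm b (S ∘L T)
      ≤ ∑' j, ‖ContinuousLinearMap.adjoint S (b j)‖ₑ * ‖T (b j)‖ₑ := by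
        refine ENNReal.tsum_le_tsum fun j => ?_
        rw [ContinuousLinearMap.comp_apply, ← ContinuousLinearMap.adjoint_inner_left]
        exact enorm_inner_le _ _
    _ ≤ hsNorm b (ContinuousLinearMap.adjoint S) * hsNorm b T := tsum_mul_le_sqrt _ _
    _ = hsNorm b S * hsNorm b T := by rw [hsNorm_adjoint]

/-- A regularized polar decomposition: `T` is within `ε` of `W B B` with `W` a contraction. -/
theorem exists_contraction_near (T A : H →L[ℂ] H) (hA : A.IsPositive) (hTA : ∀ x, ‖T x‖ = ‖A x‖)
    {ε : ℝ} (hε : 0 < ε) : ∃ W : H →L[ℂ] H, ‖W‖ ≤ 1 ∧ ‖T - W ∘L A‖ ≤ ε := by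
  set G : H →L[ℂ] H := A + (ε : ℂ) • 1 with hG
  have hGx : ∀ x, G x = A x + (ε : ℂ) • x := fun x => rfl
  -- Coercivity: $\mathrm{Re}\langle Gx,x\rangle\ge\varepsilon\|x\|^2$.
  have hunit : IsUnit G := by
    refine ContinuousLinearMap.isUnit_of_forall_le_norm_inner_map G (c := ⟨ε, hε.le⟩) hε fun x => ?_
    refine le_trans ?_ (Complex.re_le_norm _)
    rw [hGx, inner_add_left, inner_smul_left, Complex.add_re, Complex.conj_ofReal,
      inner_self_eq_norm_sq_to_K]
    have h1 := hA.re_inner_nonneg_left x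
    have h2 : ((ε : ℂ) * ((‖x‖ : ℂ)) ^ 2).re = ε * ‖x‖ ^ 2 := by norm_cast
    have h3 : (inner ℂ (A x) x).re = RCLike.re (inner ℂ (A x) x) := rfl
    change ‖x‖ ^ 2 * ε ≤ _ + ((ε : ℂ) * ((‖x‖ : ℂ)) ^ 2).re
    rw [h2, h3]
    linarith
  obtain ⟨N, hGN⟩ := hunit.exists_right_inv
  have hNG : N * G = 1 := by
    obtain ⟨N', hN'⟩ := hunit.exists_left_inv
    rwa [← left_inv_eq_right_inv hN' hGN]
  have hAG : ∀ y, ‖A y‖ ≤ ‖G y‖ := by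
    intro y
    have h1 := hA.re_inner_nonneg_left y
    have h2 : ‖G y‖ ^ 2 = ‖A y‖ ^ 2 + 2 * (ε * RCLike.re (inner ℂ (A y) y)) + (ε * ‖y‖) ^ 2 := by
      rw [hGx, @norm_add_sq ℂ, inner_smul_right, norm_smul, Complex.norm_real,
        Real.norm_of_nonneg hε.le]
      congr 3
      exact Complex.re_ofReal_mul _ _
    refine le_of_sq_le_sq ?_ (norm_nonneg _)
    rw [h2]
    nlinarith [mul_nonneg hε.le h1, sq_nonneg (ε * ‖y‖)]
  have hTN : ‖T ∘L N‖ ≤ 1 := by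
    refine ContinuousLinearMap.opNorm_le_bound _ zero_le_one fun x => ?_
    have h1 : G (N x) = x := congrArg (fun L : H →L[ℂ] H => L x) hGN
    rw [ContinuousLinearMap.comp_apply, hTA, one_mul]
    simpa [h1] using hAG (N x)
  refine ⟨T ∘L N, hTN, ?_⟩
  -- With $N=G^{-1}$, $T-TNA=TN(G-A)=\varepsilon TN$. The operator $TN$ replaces the partial
  -- isometry of the polar decomposition.
  have h1 : T - (T ∘L N) ∘L A = (ε : ℂ) • (T ∘L N) := by
    ext x
    have h2 : N (A x) + (ε : ℂ) • N x = x := by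
      have := congrArg (fun L : H →L[ℂ] H => L x) hNG
      simpa [hGx] using this
    have h3 : T x = T (N (A x)) + (ε : ℂ) • T (N x) := by
      conv_lhs => rw [← h2]
      simp
    simp [h3]
  rw [h1, norm_smul, Complex.norm_real, Real.norm_of_nonneg hε.le]
  exact mul_le_of_le_one_right hε.le hTN

/-- If $T=WB^2$ with $W$ a contraction, Cauchy–Schwarz bounds the diagonal by
$\|WB\|_{HS}\|B\|_{HS}\le\|B\|_{HS}^2$. Such a factorization is available up to $\varepsilon$ in
operator norm, which is harmless on finitely many coordinates. -/
theorem diagNorm_le_traceNorm (b : HilbertBasis ι ℂ H) (T : H →L[ℂ] H) :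
    diagNorm b T ≤ traceNorm b T := by
  obtain ⟨A, B, hA, -, hBB, hTA, htr⟩ := exists_sqrt_abs b T
  rw [diagNorm, ENNReal.tsum_eq_iSup_sum, iSup_le_iff]
  intro J
  refine ENNReal.le_of_forall_pos_le_add fun η hη _ => ?_
  -- The total error $\eta$ is shared among the coordinates in `J`; the `+ 1` covers the empty set.
  have hε : 0 < (η : ℝ) / (J.card + 1) := by positivity
  obtain ⟨W, hW, hTW⟩ := exists_contraction_near T A hA hTA hε
  have hW' : ‖W‖ₑ ≤ 1 := by
    rw [← ofReal_norm]; exact ENNReal.ofReal_le_one.2 hW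
  have h1 : ∑ j ∈ J, ‖inner ℂ (b j) ((W ∘L A) (b j))‖ₑ ≤ traceNorm b T := by
    refine (ENNReal.sum_le_tsum J).trans ?_
    change diagNorm b (W ∘L A) ≤ _
    rw [← hBB, ← ContinuousLinearMap.comp_assoc, htr, sq]
    refine (diagNorm_comp_le b _ _).trans ?_
    gcongr
    exact (hsNorm_comp_le_left b _ _).trans (by simpa using mul_le_mul_left hW' (hsNorm b B))
  have h2 : ∑ j ∈ J, ‖inner ℂ (b j) ((T - W ∘L A) (b j))‖ₑ ≤ η := by
    calc ∑ j ∈ J, ‖inner ℂ (b j) ((T - W ∘L A) (b j))‖ₑ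
        ≤ ∑ _j ∈ J, ENNReal.ofReal ((η : ℝ) / (J.card + 1)) := by
          refine Finset.sum_le_sum fun j _ => ?_
          rw [← ofReal_norm]
          refine ENNReal.ofReal_le_ofReal ((norm_inner_le_norm _ _).trans ?_)
          rw [b.orthonormal.1, one_mul]
          refine (ContinuousLinearMap.le_opNorm _ _).trans ?_
          rw [b.orthonormal.1, mul_one]
          exact hTW
      _ = ENNReal.ofReal (J.card * ((η : ℝ) / (J.card + 1))) := by
          rw [Finset.sum_const, nsmul_eq_mul, ENNReal.ofReal_mul (by positivity),
            ENNReal.ofReal_natCast]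
      _ ≤ ENNReal.ofReal η := by
          refine ENNReal.ofReal_le_ofReal ?_
          rw [mul_div_assoc', div_le_iff₀ (by positivity)]
          nlinarith [η.coe_nonneg]
      _ = η := ENNReal.ofReal_coe_nnreal
  calc ∑ j ∈ J, ‖inner ℂ (b j) (T (b j))‖ₑ
      ≤ ∑ j ∈ J, (‖inner ℂ (b j) ((W ∘L A) (b j))‖ₑ +
          ‖inner ℂ (b j) ((T - W ∘L A) (b j))‖ₑ) := by
        refine Finset.sum_le_sum fun j _ => (enorm_add_le _ _).trans_eq' ?_
        rw [← inner_add_right, ← add_apply, add_sub_cancel]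
    _ ≤ traceNorm b T + η := by
        rw [Finset.sum_add_distrib]
        exact add_le_add h1 h2

/-- The sum of the Hilbert-Schmidt norm and the diagonal norm, which is at most twice the trace
norm. -/
noncomputable def crossNorm (b : HilbertBasis ι ℂ H) (T : H →L[ℂ] H) : ℝ≥0∞ :=
  hsNorm b T + diagNorm b T

theorem crossNorm_le (b : HilbertBasis ι ℂ H) (T : H →L[ℂ] H) :
    crossNorm b T ≤ 2 * traceNorm b T := by
  rw [two_mul]
  exact add_le_add (hsNorm_le_traceNorm b T) (diagNorm_le_traceNorm b T)

theorem crossNorm_add_le (b : HilbertBasis ι ℂ H) (S T : H →L[ℂ] H) :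
    crossNorm b (S + T) ≤ crossNorm b S + crossNorm b T :=
  (add_le_add (hsNorm_add_le b S T) (diagNorm_add_le b S T)).trans_eq (add_add_add_comm _ _ _ _)

end Operators

/-! ### Fourth moments of Gaussian variables -/

section Gaussian

variable {Ω : Type*} [MeasurableSpace Ω] {P : Measure Ω}

/-- The fourth derivative at $0$ of the moment generating function $e^{vt^2/2}$; differentiating
$p(t)e^{vt^2/2}$ replaces $p$ by $p'+vtp$. -/
theorem integral_pow_four_gaussianReal (v : ℝ≥0) :
    ∫ x, x ^ 4 ∂(gaussianReal 0 v) = 3 * (v : ℝ) ^ 2 := by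
  have h0 : (0 : ℝ) ∈ interior (integrableExpSet id (gaussianReal 0 v)) := by
    rw [integrableExpSet_id_gaussianReal, interior_univ]
    trivial
  have h1 := iteratedDeriv_mgf_zero h0 4
  rw [mgf_id_gaussianReal] at h1
  have hE : ∀ t : ℝ, HasDerivAt (fun t : ℝ => Real.exp (0 * t + v * t ^ 2 / 2))
      (v * t * Real.exp (0 * t + v * t ^ 2 / 2)) t := by
    intro t
    have h2 : HasDerivAt (fun t : ℝ => 0 * t + v * t ^ 2 / 2) (v * t) t :=
      (((hasDerivAt_id' t).const_mul 0).fun_add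
        (((hasDerivAt_pow 2 t).const_mul (v : ℝ)).div_const 2)).congr_deriv (by push_cast; ring)
    exact h2.exp.congr_deriv (mul_comm _ _)
  have step : ∀ (p p' : ℝ → ℝ), (∀ t, HasDerivAt p (p' t) t) →
      deriv (fun t => p t * Real.exp (0 * t + v * t ^ 2 / 2)) =
        fun t => (p' t + v * t * p t) * Real.exp (0 * t + v * t ^ 2 / 2) := by
    intro p p' hp
    ext t
    rw [((hp t).fun_mul (hE t)).deriv]
    ring
  have d1 : deriv (fun t : ℝ => Real.exp (0 * t + v * t ^ 2 / 2)) =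
      fun t => (v * t) * Real.exp (0 * t + v * t ^ 2 / 2) := by
    ext t
    rw [(hE t).deriv]
  have hv : ∀ t : ℝ, HasDerivAt (fun t : ℝ => (v : ℝ) * t) v t :=
    fun t => ((hasDerivAt_id' t).const_mul (v : ℝ)).congr_deriv (mul_one _)
  have hv2 : ∀ t : ℝ, HasDerivAt (fun t : ℝ => (v : ℝ) + v * t * (v * t)) (2 * v ^ 2 * t) t :=
    fun t => (((hv t).fun_mul (hv t)).const_add (v : ℝ)).congr_deriv (by ring)
  have d2 := step (fun t => v * t) (fun _ => v) hv
  have d3 := step (fun t => v + v * t * (v * t)) (fun t => 2 * v ^ 2 * t) hv2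
  have d4 := step (fun t => 2 * v ^ 2 * t + v * t * (v + v * t * (v * t)))
      (fun t => 3 * v ^ 2 + 3 * v ^ 3 * t ^ 2) fun t =>
    (((hasDerivAt_id' t).const_mul (2 * (v : ℝ) ^ 2)).fun_add
      ((hv t).fun_mul (hv2 t))).congr_deriv (by ring)
  rw [iteratedDeriv_succ, iteratedDeriv_succ, iteratedDeriv_succ, iteratedDeriv_succ,
    iteratedDeriv_zero, d1, d2, d3, d4] at h1
  simpa using h1.symm

theorem integral_pow_four_of_gaussian {Y : Ω → ℝ} (hY : HasGaussianLaw Y P)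
    (h0 : ∫ ω, Y ω ∂P = 0) : ∫ ω, Y ω ^ 4 ∂P = 3 * (∫ ω, Y ω ^ 2 ∂P) ^ 2 := by
  have := hY.isProbabilityMeasure
  have h1 : ∫ ω, Y ω ^ 4 ∂P = ∫ x, x ^ 4 ∂(P.map Y) :=
    (integral_map hY.aemeasurable
      (continuous_pow 4).aestronglyMeasurable).symm
  rw [h1, hY.map_eq_gaussianReal, h0, integral_pow_four_gaussianReal,
    Real.coe_toNNReal _ (variance_nonneg _ _), variance_of_integral_eq_zero hY.aemeasurable h0]

/-- Isserlis' formula for the fourth mixed moment of a centered Gaussian vector. -/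
theorem integral_mul_four_of_gaussian (Z : Fin 4 → Ω → ℝ)
    (hZ : ∀ e : Fin 4 → ℝ, HasGaussianLaw (fun ω => ∑ i, e i * Z i ω) P)
    (h0 : ∀ i, ∫ ω, Z i ω ∂P = 0) :
    ∫ ω, Z 0 ω * Z 1 ω * Z 2 ω * Z 3 ω ∂P =
      (∫ ω, Z 0 ω * Z 1 ω ∂P) * (∫ ω, Z 2 ω * Z 3 ω ∂P) +
      (∫ ω, Z 0 ω * Z 2 ω ∂P) * (∫ ω, Z 1 ω * Z 3 ω ∂P) +
      (∫ ω, Z 0 ω * Z 3 ω ∂P) * (∫ ω, Z 1 ω * Z 2 ω ∂P) := by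
  have hZi : ∀ i, HasGaussianLaw (Z i) P := by
    intro i
    have := hZ (Pi.single i 1)
    simpa [Pi.single_apply] using this
  set G : Fin 4 → Fin 4 → ℝ := fun i j => ∫ ω, Z i ω * Z j ω ∂P with hG
  have hsymm : ∀ i j, G i j = G j i := fun i j => by simp only [hG, mul_comm]
  have hint : ∀ i j, Integrable (fun ω => Z i ω * Z j ω) P :=
    fun i j => (hZi i).memLp_two.integrable_mul (hZi j).memLp_two
  have hsq : ∀ e : Fin 4 → ℝ, ∫ ω, (∑ i, e i * Z i ω) ^ 2 ∂P = ∑ i, ∑ j, e i * e j * G i j := by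
    intro e
    have h1 : ∀ ω, (∑ i, e i * Z i ω) ^ 2 = ∑ i, ∑ j, e i * e j * (Z i ω * Z j ω) := by
      intro ω
      rw [sq, Finset.sum_mul_sum]
      exact Finset.sum_congr rfl fun i _ => Finset.sum_congr rfl fun j _ => by ring
    simp_rw [h1]
    rw [integral_finsetSum _ fun i _ => integrable_finsetSum _ fun j _ => (hint i j).const_mul _]
    refine Finset.sum_congr rfl fun i _ => ?_
    rw [integral_finsetSum _ fun j _ => (hint i j).const_mul _]
    exact Finset.sum_congr rfl fun j _ => integral_const_mul _ _
  have hfour : ∀ e : Fin 4 → ℝ, ∫ ω, (∑ i, e i * Z i ω) ^ 4 ∂P =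
      3 * (∑ i, ∑ j, e i * e j * G i j) ^ 2 := by
    intro e
    rw [integral_pow_four_of_gaussian (hZ e), hsq]
    rw [integral_finsetSum _ fun i _ => (hZi i).integrable.const_mul _]
    simp [integral_const_mul, h0]
  have hint4 : ∀ e : Fin 4 → ℝ, Integrable (fun ω => (∑ i, e i * Z i ω) ^ 4) P := by
    intro e
    have h1 := ((hZ e).memLp (p := 4) (by norm_num)).integrable_norm_pow (by norm_num)
    refine h1.congr (ae_of_all _ fun ω => ?_)
    simp only [Real.norm_eq_abs]
    exact Even.pow_abs (by decide) _
  -- Polarization: in the signed sum of the fourth powers of $z_0\pm z_1\pm z_2\pm z_3$ over the $8$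
  -- sign patterns, only $4!\,z_0z_1z_2z_3$ survives, and $192=8\cdot4!$. Only fourth moments of
  -- linear combinations are then needed.
  have hpol : ∀ ω, Z 0 ω * Z 1 ω * Z 2 ω * Z 3 ω =
      (1 / 192) * ∑ e : Fin 2 × Fin 2 × Fin 2, (-1) ^ (e.1 + e.2.1 + e.2.2 : ℕ) *
        (∑ i, (![1, (-1) ^ (e.1 : ℕ), (-1) ^ (e.2.1 : ℕ), (-1) ^ (e.2.2 : ℕ)] : Fin 4 → ℝ) i *
          Z i ω) ^ 4 := by
    intro ω
    simp only [Fintype.sum_prod_type, Fin.sum_univ_two, Fin.sum_univ_four]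
    simp
    ring
  simp_rw [hpol]
  rw [integral_const_mul, integral_finsetSum _ fun e _ => (hint4 _).const_mul _]
  simp_rw [integral_const_mul, hfour]
  change _ = G 0 1 * G 2 3 + G 0 2 * G 1 3 + G 0 3 * G 1 2
  simp only [Fintype.sum_prod_type, Fin.sum_univ_two, Fin.sum_univ_four]
  rw [hsymm 1 0, hsymm 2 0, hsymm 3 0, hsymm 2 1, hsymm 3 1, hsymm 3 2]
  simp
  ring

theorem lintegral_enorm_sum_sq_le {κ : Type*} (I : Finset κ) (a : κ → ℂ) (U : κ → Ω → ℝ)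
    (hU : ∀ i ∈ I, MemLp (U i) 2 P) :
    ∫⁻ ω, ‖∑ i ∈ I, a i * (U i ω : ℂ)‖ₑ ^ 2 ∂P ≤
      ∑ i ∈ I, ∑ j ∈ I, ‖a i‖ₑ * ‖a j‖ₑ * ‖∫ ω, U i ω * U j ω ∂P‖ₑ := by
  have hint : ∀ i ∈ I, ∀ j ∈ I, Integrable (fun ω => U i ω * U j ω) P :=
    fun i hi j hj => (hU i hi).integrable_mul (hU j hj)
  have h1 : ∀ ω, ‖∑ i ∈ I, a i * (U i ω : ℂ)‖ ^ 2 =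
      ∑ i ∈ I, ∑ j ∈ I, (a i * starRingEnd ℂ (a j)).re * (U i ω * U j ω) := by
    intro ω
    rw [← Complex.normSq_eq_norm_sq, ← Complex.ofReal_re (Complex.normSq _),
      ← Complex.mul_conj, map_sum, Finset.sum_mul_sum, Complex.re_sum]
    refine Finset.sum_congr rfl fun i _ => ?_
    rw [Complex.re_sum]
    refine Finset.sum_congr rfl fun j _ => ?_
    rw [map_mul, Complex.conj_ofReal, mul_mul_mul_comm, ← Complex.ofReal_mul, Complex.re_mul_ofReal]
  have h2 : ∀ ω, ‖∑ i ∈ I, a i * (U i ω : ℂ)‖ₑ ^ 2 =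
      ENNReal.ofReal (‖∑ i ∈ I, a i * (U i ω : ℂ)‖ ^ 2) := fun ω => by
    rw [ENNReal.ofReal_pow (norm_nonneg _), ofReal_norm]
  have hint2 : ∀ i ∈ I, ∀ j ∈ I,
      Integrable (fun ω => (a i * starRingEnd ℂ (a j)).re * (U i ω * U j ω)) P :=
    fun i hi j hj => (hint i hi j hj).const_mul _
  have h3 : Integrable (fun ω => ‖∑ i ∈ I, a i * (U i ω : ℂ)‖ ^ 2) P := by
    simp_rw [h1]
    exact integrable_finsetSum _ fun i hi => integrable_finsetSum _ fun j hj => hint2 i hi j hj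
  simp_rw [h2]
  rw [← ofReal_integral_eq_lintegral_ofReal h3 (ae_of_all _ fun ω => by positivity)]
  refine (Real.ofReal_le_enorm _).trans ?_
  simp_rw [h1]
  rw [integral_finsetSum _ fun i hi => integrable_finsetSum _ fun j hj => hint2 i hi j hj]
  refine (enorm_sum_le _ _).trans (Finset.sum_le_sum fun i hi => ?_)
  rw [integral_finsetSum _ fun j hj => hint2 i hi j hj]
  refine (enorm_sum_le _ _).trans (Finset.sum_le_sum fun j hj => ?_)
  rw [integral_const_mul, enorm_mul]
  gcongr
  rw [← enorm_mul, ← ofReal_norm, ← ofReal_norm]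
  refine ENNReal.ofReal_le_ofReal ((Complex.abs_re_le_norm _).trans_eq ?_)
  rw [norm_mul, norm_mul, RCLike.norm_conj]

end Gaussian

/-! ### Second moments of quadratic forms in the process -/

section GaussianProcess

variable {d : ℕ} {H : Type*} [NormedAddCommGroup H] [InnerProductSpace ℂ H] [CompleteSpace H]
  [TopologicalSpace.SeparableSpace H] [MeasurableSpace H] [BorelSpace H]
  {ι : Type*} {Ω : Type*} [MeasurableSpace Ω] {P : Measure Ω}
  {X : EuclideanSpace ℝ (Fin d) → Ω → H} {b : HilbertBasis ι ℂ H}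

/-- The real coordinate functional `x ↦ Re ⟨e_j, x⟩`. -/
noncomputable def realCoord (b : HilbertBasis ι ℂ H) (j : ι) : H →L[ℝ] ℝ :=
  Complex.reCLM ∘L (innerSL ℂ (b j)).restrictScalars ℝ

theorem IsRealVector.inner_eq {x : H} (hx : IsRealVector b x) (j : ι) :
    inner ℂ (b j) x = (realCoord b j x : ℂ) :=
  Complex.ext rfl (by simpa using hx j)

theorem IsStationaryGaussian.memLp (hX : IsStationaryGaussian P b X)
    (t : EuclideanSpace ℝ (Fin d)) : MemLp (X t) 2 P := by
  have := UniformSpace.secondCountable_of_separable H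
  exact (hX.gaussian.hasGaussianLaw_eval t).memLp_two

theorem IsStationaryGaussian.integrable_rankOne (hX : IsStationaryGaussian P b X)
    (t s : EuclideanSpace ℝ (Fin d)) :
    Integrable (fun ω => InnerProductSpace.rankOne ℂ (X t ω) (X s ω)) P := by
  have := UniformSpace.secondCountable_of_separable H
  have hc : Continuous fun p : H × H => InnerProductSpace.rankOne ℂ p.1 p.2 :=
    (ContinuousLinearMap.smulRightL ℂ H H).continuous₂.comp
      (((innerSL ℂ).continuous.comp continuous_snd).prodMk continuous_fst)
  have hm := hc.comp_aestronglyMeasurable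
    ((hX.memLp t).aestronglyMeasurable.prodMk (hX.memLp s).aestronglyMeasurable)
  refine ((hX.memLp t).norm.integrable_mul (hX.memLp s).norm).mono' hm (ae_of_all _ fun ω => ?_)
  exact (InnerProductSpace.norm_rankOne _ _).le

theorem IsStationaryGaussian.covOp_eq (hX : IsStationaryGaussian P b X)
    (t s : EuclideanSpace ℝ (Fin d)) : covOp P X t s = autocov P X (t - s) := by
  simpa using hX.stationary s (t - s)

theorem IsStationaryGaussian.integral_realCoord (hX : IsStationaryGaussian P b X)
    (t : EuclideanSpace ℝ (Fin d)) (j : ι) : ∫ ω, realCoord b j (X t ω) ∂P = 0 := by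
  have := UniformSpace.secondCountable_of_separable H
  rw [ContinuousLinearMap.integral_comp_comm _ (hX.gaussian.hasGaussianLaw_eval t).integrable,
    hX.zero_mean, map_zero]

/-- Reality of $X$ turns the matrix entries of $C$ into real covariances of coordinates, so the real
Isserlis formula applies and no pseudo-covariance appears. -/
theorem IsStationaryGaussian.inner_autocov (hX : IsStationaryGaussian P b X)
    (t s : EuclideanSpace ℝ (Fin d)) (j k : ι) :
    inner ℂ (b k) (autocov P X (t - s) (b j)) =
      ((∫ ω, realCoord b k (X t ω) * realCoord b j (X s ω) ∂P : ℝ) : ℂ) := by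
  rw [← hX.covOp_eq, covOp, ← integral_complex_ofReal]
  have h1 := ContinuousLinearMap.integral_comp_comm
    ((innerSL ℂ (b k)) ∘L (ContinuousLinearMap.apply ℂ H (b j))) (hX.integrable_rankOne t s)
  refine h1.symm.trans (integral_congr_ae ?_)
  filter_upwards [hX.real t, hX.real s] with ω ht hs
  have h2 : inner ℂ (b k) (InnerProductSpace.rankOne ℂ (X t ω) (X s ω) (b j)) =
      ((realCoord b k (X t ω) * realCoord b j (X s ω) : ℝ) : ℂ) := by
    rw [InnerProductSpace.rankOne_apply, inner_smul_right, ht.inner_eq, ← inner_conj_symm,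
      hs.inner_eq, Complex.conj_ofReal, mul_comm, Complex.ofReal_mul]
  exact h2

theorem IsStationaryGaussian.hasGaussianLaw_sum (hX : IsStationaryGaussian P b X)
    {n : ℕ} (t : Fin n → EuclideanSpace ℝ (Fin d)) (j : Fin n → ι) (e : Fin n → ℝ) :
    HasGaussianLaw (fun ω => ∑ i, e i * realCoord b (j i) (X (t i) ω)) P := by
  classical
  -- The times may repeat, so the joint law is taken on their image and each coordinate is read off
  -- from it.
  have h1 := hX.gaussian.hasGaussianLaw (Finset.univ.image t)
  have hmem : ∀ i, t i ∈ Finset.univ.image t := fun i => Finset.mem_image_of_mem t (Finset.mem_univ i)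
  let L : ((Finset.univ.image t) → H) →L[ℝ] ℝ :=
    ∑ i, e i • (realCoord b (j i) ∘L ContinuousLinearMap.proj (⟨t i, hmem i⟩ : Finset.univ.image t))
  have h2 := h1.map_fun L
  refine h2.congr (ae_of_all _ fun ω => ?_)
  simp only [L, sum_apply, smul_apply, smul_eq_mul]
  rfl

theorem IsStationaryGaussian.memLp_realCoord_mul (hX : IsStationaryGaussian P b X)
    (t s : EuclideanSpace ℝ (Fin d)) (j k : ι) :
    MemLp (fun ω => realCoord b k (X t ω) * realCoord b j (X s ω)) 2 P := by
  have := UniformSpace.secondCountable_of_separable H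
  have h : ∀ t k, MemLp (fun ω => realCoord b k (X t ω)) 4 P := fun t k =>
    ((hX.gaussian.hasGaussianLaw_eval t).map_fun (realCoord b k)).memLp (by norm_num)
  have h4 : ENNReal.HolderTriple 4 4 2 := ⟨by
    rw [← two_mul, show (4 : ℝ≥0∞) = 2 * 2 by norm_num, ENNReal.mul_inv (by simp) (by simp),
      ← mul_assoc, ENNReal.mul_inv_cancel (by simp) (by simp), one_mul]⟩
  exact (h s j).mul (h t k)

/-- Of the three pairings in Isserlis' formula, centring removes the one that pairs each product
with itself. -/
theorem IsStationaryGaussian.integral_centered_mul (hX : IsStationaryGaussian P b X)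
    (t s t' s' : EuclideanSpace ℝ (Fin d)) (j k : ι) :
    ∫ ω, (realCoord b k (X t ω) * realCoord b j (X s ω) -
        ∫ ω', realCoord b k (X t ω') * realCoord b j (X s ω') ∂P) *
      (realCoord b k (X t' ω) * realCoord b j (X s' ω) -
        ∫ ω', realCoord b k (X t' ω') * realCoord b j (X s' ω') ∂P) ∂P =
    (∫ ω, realCoord b k (X t ω) * realCoord b k (X t' ω) ∂P) *
        (∫ ω, realCoord b j (X s ω) * realCoord b j (X s' ω) ∂P) +
      (∫ ω, realCoord b k (X t ω) * realCoord b j (X s' ω) ∂P) *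
        (∫ ω, realCoord b j (X s ω) * realCoord b k (X t' ω) ∂P) := by
  have := hX.gaussian.isProbabilityMeasure
  have h4 := integral_mul_four_of_gaussian (P := P)
    (fun i ω => realCoord b (![k, j, k, j] i) (X (![t, s, t', s'] i) ω))
    (fun e => hX.hasGaussianLaw_sum _ _ e) (fun i => hX.integral_realCoord _ _)
  simp only [Matrix.cons_val] at h4
  set c := ∫ ω', realCoord b k (X t ω') * realCoord b j (X s ω') ∂P with hc
  set c' := ∫ ω', realCoord b k (X t' ω') * realCoord b j (X s' ω') ∂P with hc'
  have m1 := hX.memLp_realCoord_mul t s j k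
  have m2 := hX.memLp_realCoord_mul t' s' j k
  have i1 := m1.integrable (by norm_num)
  have i2 := m2.integrable (by norm_num)
  have i12 := m1.integrable_mul m2
  have h5 : ∀ ω, (realCoord b k (X t ω) * realCoord b j (X s ω) - c) *
      (realCoord b k (X t' ω) * realCoord b j (X s' ω) - c') =
      realCoord b k (X t ω) * realCoord b j (X s ω) * realCoord b k (X t' ω) *
        realCoord b j (X s' ω) - c' * (realCoord b k (X t ω) * realCoord b j (X s ω)) -
      c * (realCoord b k (X t' ω) * realCoord b j (X s' ω)) + c * c' := fun ω => by ring
  have i12' : Integrable (fun ω => realCoord b k (X t ω) * realCoord b j (X s ω) *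
      realCoord b k (X t' ω) * realCoord b j (X s' ω)) P := by
    refine i12.congr (ae_of_all _ fun ω => ?_)
    simp only [Pi.mul_apply]
    ring
  have i3 : Integrable (fun ω => realCoord b k (X t ω) * realCoord b j (X s ω) *
      realCoord b k (X t' ω) * realCoord b j (X s' ω) -
      c' * (realCoord b k (X t ω) * realCoord b j (X s ω))) P := i12'.sub (i1.const_mul c')
  simp_rw [h5]
  rw [integral_add (by exact i3.sub (i2.const_mul c)) (integrable_const _), integral_sub i3 (i2.const_mul c),
    integral_sub i12' (i1.const_mul c'), integral_const_mul, integral_const_mul, h4, ← hc, ← hc']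
  simp
  ring

theorem tsum_tsum_mul_le (b : HilbertBasis ι ℂ H) (S T : H →L[ℂ] H) :
    ∑' j, ∑' k, ‖inner ℂ (b k) (S (b j))‖ₑ * ‖inner ℂ (b j) (T (b k))‖ₑ ≤
      hsNorm b S * hsNorm b T := by
  have hS : hsNorm b S = (∑' p : ι × ι, ‖inner ℂ (b p.2) (S (b p.1))‖ₑ ^ 2) ^ (1 / 2 : ℝ) := by
    rw [ENNReal.tsum_prod (f := fun j k => ‖inner ℂ (b k) (S (b j))‖ₑ ^ 2),
      ← hsNorm_sq_eq_tsum_inner, ← ENNReal.rpow_natCast, ← ENNReal.rpow_mul]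
    norm_num
  have hT : hsNorm b T = (∑' p : ι × ι, ‖inner ℂ (b p.1) (T (b p.2))‖ₑ ^ 2) ^ (1 / 2 : ℝ) := by
    rw [ENNReal.tsum_prod (f := fun j k => ‖inner ℂ (b j) (T (b k))‖ₑ ^ 2), ENNReal.tsum_comm,
      ← hsNorm_sq_eq_tsum_inner, ← ENNReal.rpow_natCast, ← ENNReal.rpow_mul]
    norm_num
  rw [hS, hT, ← ENNReal.tsum_prod
    (f := fun j k => ‖inner ℂ (b k) (S (b j))‖ₑ * ‖inner ℂ (b j) (T (b k))‖ₑ)]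
  exact tsum_mul_le_sqrt _ _

/-- The second moment of a centered quadratic form in a Gaussian process. -/
theorem IsStationaryGaussian.lintegral_hsNorm_sq_le (hX : IsStationaryGaussian P b X)
    {κ : Type*} (I : Finset κ) (τ σ : κ → EuclideanSpace ℝ (Fin d)) (a : κ → ℂ) :
    ∫⁻ ω, hsNorm b (∑ p ∈ I, a p • (InnerProductSpace.rankOne ℂ (X (τ p) ω) (X (σ p) ω) -
        autocov P X (τ p - σ p))) ^ 2 ∂P ≤
      ∑ p ∈ I, ∑ q ∈ I, ‖a p‖ₑ * ‖a q‖ₑ *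
        (diagNorm b (autocov P X (τ p - τ q)) * diagNorm b (autocov P X (σ p - σ q)) +
          hsNorm b (autocov P X (τ p - σ q)) * hsNorm b (autocov P X (σ p - τ q))) := by
  have := hX.gaussian.isProbabilityMeasure
  have := UniformSpace.secondCountable_of_separable H
  have := countable_of_hilbertBasis b
  set C := autocov P X with hC
  set U : ι → ι → κ → Ω → ℝ := fun j k p ω =>
    realCoord b k (X (τ p) ω) * realCoord b j (X (σ p) ω) -
      ∫ ω', realCoord b k (X (τ p) ω') * realCoord b j (X (σ p) ω') ∂P with hU
  have hY : ∀ᵐ ω ∂P, ∀ j k,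
      inner ℂ (b k) ((∑ p ∈ I, a p • (InnerProductSpace.rankOne ℂ (X (τ p) ω) (X (σ p) ω) -
        C (τ p - σ p))) (b j)) = ∑ p ∈ I, a p * (U j k p ω : ℂ) := by
    have hr : ∀ᵐ ω ∂P, ∀ p ∈ I, IsRealVector b (X (τ p) ω) ∧ IsRealVector b (X (σ p) ω) :=
      (Filter.eventually_all_finset I).2 fun p _ => (hX.real _).and (hX.real _)
    filter_upwards [hr] with ω hω j k
    rw [sum_apply, inner_sum]
    refine Finset.sum_congr rfl fun p hp => ?_
    rw [smul_apply, inner_smul_right, sub_apply,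
      inner_sub_right, hX.inner_autocov, InnerProductSpace.rankOne_apply, inner_smul_right,
      (hω p hp).1.inner_eq, ← inner_conj_symm, (hω p hp).2.inner_eq, Complex.conj_ofReal, hU]
    push_cast
    ring
  have hmemU : ∀ j k p, MemLp (U j k p) 2 P := fun j k p =>
    (hX.memLp_realCoord_mul _ _ j k).sub (memLp_const _)
  have hcov : ∀ j k p q, ‖∫ ω, U j k p ω * U j k q ω ∂P‖ₑ ≤
      ‖inner ℂ (b k) (C (τ p - τ q) (b k))‖ₑ * ‖inner ℂ (b j) (C (σ p - σ q) (b j))‖ₑ +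
      ‖inner ℂ (b k) (C (τ p - σ q) (b j))‖ₑ * ‖inner ℂ (b j) (C (σ p - τ q) (b k))‖ₑ := by
    intro j k p q
    have he : ∀ x : ℝ, ‖(x : ℂ)‖ₑ = ‖x‖ₑ := fun x => by
      rw [← ofReal_norm, ← ofReal_norm, Complex.norm_real]
    rw [hC, hX.inner_autocov, hX.inner_autocov, hX.inner_autocov, hX.inner_autocov, hU,
      hX.integral_centered_mul, he, he, he, he]
    exact (enorm_add_le _ _).trans_eq (by rw [enorm_mul, enorm_mul])
  have hmeas : ∀ j k, AEMeasurable (fun ω => ‖∑ p ∈ I, a p * (U j k p ω : ℂ)‖ₑ ^ 2) P := by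
    intro j k
    have h1 : ∀ p, AEMeasurable (U j k p) P := fun p => (hmemU j k p).aestronglyMeasurable.aemeasurable
    fun_prop
  calc ∫⁻ ω, hsNorm b (∑ p ∈ I, a p • (InnerProductSpace.rankOne ℂ (X (τ p) ω) (X (σ p) ω) -
        C (τ p - σ p))) ^ 2 ∂P
      = ∫⁻ ω, ∑' j, ∑' k, ‖∑ p ∈ I, a p * (U j k p ω : ℂ)‖ₑ ^ 2 ∂P := by
        refine lintegral_congr_ae ?_
        filter_upwards [hY] with ω hω
        rw [hsNorm_sq_eq_tsum_inner]
        simp_rw [hω]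
    _ = ∑' j, ∑' k, ∫⁻ ω, ‖∑ p ∈ I, a p * (U j k p ω : ℂ)‖ₑ ^ 2 ∂P := by
        rw [lintegral_tsum fun j => AEMeasurable.tsum fun k => hmeas j k]
        exact tsum_congr fun j => lintegral_tsum fun k => hmeas j k
    _ ≤ ∑' j, ∑' k, ∑ p ∈ I, ∑ q ∈ I, ‖a p‖ₑ * ‖a q‖ₑ *
        (‖inner ℂ (b k) (C (τ p - τ q) (b k))‖ₑ * ‖inner ℂ (b j) (C (σ p - σ q) (b j))‖ₑ +
        ‖inner ℂ (b k) (C (τ p - σ q) (b j))‖ₑ * ‖inner ℂ (b j) (C (σ p - τ q) (b k))‖ₑ) := by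
        refine ENNReal.tsum_le_tsum fun j => ENNReal.tsum_le_tsum fun k => ?_
        refine (lintegral_enorm_sum_sq_le I a _ fun p _ => hmemU j k p).trans ?_
        refine Finset.sum_le_sum fun p _ => Finset.sum_le_sum fun q _ => ?_
        gcongr
        exact hcov j k p q
    _ = ∑ p ∈ I, ∑ q ∈ I, ‖a p‖ₑ * ‖a q‖ₑ * ∑' j, ∑' k,
        (‖inner ℂ (b k) (C (τ p - τ q) (b k))‖ₑ * ‖inner ℂ (b j) (C (σ p - σ q) (b j))‖ₑ +
        ‖inner ℂ (b k) (C (τ p - σ q) (b j))‖ₑ * ‖inner ℂ (b j) (C (σ p - τ q) (b k))‖ₑ) := by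
        simp_rw [Summable.tsum_finsetSum (fun _ _ => ENNReal.summable), ENNReal.tsum_mul_left]
    _ ≤ _ := by
        refine Finset.sum_le_sum fun p _ => Finset.sum_le_sum fun q _ => ?_
        gcongr
        -- The first pairing separates the indices $j,k$ into a product of two diagonal sums; the
        -- second couples them and is handled by Cauchy–Schwarz over pairs.
        simp_rw [ENNReal.tsum_add]
        refine add_le_add (le_of_eq ?_) (tsum_tsum_mul_le b _ _)
        simp_rw [ENNReal.tsum_mul_right]
        rw [ENNReal.tsum_mul_left]
        rfl

end GaussianProcess

/-! ### Voronoi cells, overlaps of translates and inradii -/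

section Geometry

variable {d : ℕ}

theorem isCompact_region (S : Finset (EuclideanSpace ℝ (Fin d))) : IsCompact (region S) :=
  S.finite_toSet.isCompact_convexHull ℝ

theorem convex_region (S : Finset (EuclideanSpace ℝ (Fin d))) : Convex ℝ (region S) :=
  convex_convexHull ℝ _

theorem measurableSet_region (S : Finset (EuclideanSpace ℝ (Fin d))) : MeasurableSet (region S) :=
  (isCompact_region S).isClosed.measurableSet

theorem measurableSet_cell (S : Finset (EuclideanSpace ℝ (Fin d)))
    (t : EuclideanSpace ℝ (Fin d)) : MeasurableSet (cell S t) := by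
  have h : cell S t = region S ∩ ⋂ s ∈ S, {x | dist x t ≤ dist x s} := by
    ext x
    simp [cell]
  rw [h]
  refine (measurableSet_region S).inter (IsClosed.measurableSet ?_)
  exact isClosed_biInter fun s _ => isClosed_le (by fun_prop) (by fun_prop)

theorem cell_subset_region (S : Finset (EuclideanSpace ℝ (Fin d)))
    (t : EuclideanSpace ℝ (Fin d)) : cell S t ⊆ region S := fun _ hx => hx.1

theorem iUnion_cell (S : Finset (EuclideanSpace ℝ (Fin d))) : ⋃ t ∈ S, cell S t = region S := by
  refine Set.Subset.antisymm (Set.iUnion₂_subset fun t _ => cell_subset_region S t) fun x hx => ?_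
  have hS : S.Nonempty := by
    by_contra h
    rw [Finset.not_nonempty_iff_eq_empty] at h
    simp [h, region] at hx
  obtain ⟨t, ht, hmin⟩ := S.exists_min_image (fun s => dist x s) hS
  exact Set.mem_biUnion ht ⟨hx, hmin⟩

/-- Two cells meet only inside a perpendicular bisector, which is a proper affine subspace. -/
theorem volume_cell_inter_cell {S : Finset (EuclideanSpace ℝ (Fin d))}
    {t s : EuclideanSpace ℝ (Fin d)} (ht : t ∈ S) (hs : s ∈ S) (hts : t ≠ s) :
    volume (cell S t ∩ cell S s) = 0 := by
  refine measure_mono_null (t := (AffineSubspace.perpBisector t s : Set _)) ?_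
    (Measure.addHaar_affineSubspace _ _ (by simpa using hts))
  intro x hx
  rw [SetLike.mem_coe, AffineSubspace.mem_perpBisector_iff_dist_eq]
  exact le_antisymm (hx.1.2 s hs) (hx.2.2 t ht)

theorem restrict_region (S : Finset (EuclideanSpace ℝ (Fin d))) :
    (volume : Measure (EuclideanSpace ℝ (Fin d))).restrict (region S) =
      ∑ t ∈ S, volume.restrict (cell S t) := by
  ext A hA
  have h := lintegral_biUnion_finset₀ (μ := volume) (s := S) (t := cell S)
    (fun t ht s hs hts => volume_cell_inter_cell ht hs hts)
    (fun t _ => (measurableSet_cell S t).nullMeasurableSet) (A.indicator 1)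
  rw [iUnion_cell] at h
  simpa [lintegral_indicator_one hA] using h

theorem sum_volume_cell (S : Finset (EuclideanSpace ℝ (Fin d))) :
    ∑ t ∈ S, volume (cell S t) = volume (region S) := by
  have h := congrArg (fun μ : Measure (EuclideanSpace ℝ (Fin d)) => μ Set.univ) (restrict_region S)
  simpa using h.symm

theorem volume_cell_lt_top (S : Finset (EuclideanSpace ℝ (Fin d)))
    (t : EuclideanSpace ℝ (Fin d)) : volume (cell S t) < ∞ :=
  (measure_mono (cell_subset_region S t)).trans_lt (isCompact_region S).measure_lt_top

theorem meshSize_nonneg (S : Finset (EuclideanSpace ℝ (Fin d))) : 0 ≤ meshSize S := by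
  refine Real.sSup_nonneg ?_
  rintro r ⟨t, -, x, -, rfl⟩
  exact dist_nonneg

theorem dist_le_meshSize {S : Finset (EuclideanSpace ℝ (Fin d))}
    {t x : EuclideanSpace ℝ (Fin d)} (ht : t ∈ S) (hx : x ∈ cell S t) :
    dist x t ≤ meshSize S := by
  refine le_csSup ⟨Metric.diam (region S), ?_⟩ ⟨t, ht, x, hx, rfl⟩
  rintro r ⟨s, hs, y, hy, rfl⟩
  exact Metric.dist_le_diam_of_mem (isCompact_region S).isBounded hy.1
    (subset_convexHull ℝ _ hs)

/-- Zero mesh would make the region a finite, hence null, set. Positivity is needed to apply the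
Hölder bound at the scale of the mesh. -/
theorem meshSize_pos [Nontrivial (EuclideanSpace ℝ (Fin d))]
    {S : Finset (EuclideanSpace ℝ (Fin d))} (h : 0 < volume.real (region S)) :
    0 < meshSize S := by
  refine (meshSize_nonneg S).lt_of_ne fun h0 => h.ne' ?_
  have hsub : region S ⊆ S := by
    intro x hx
    rw [← iUnion_cell, Set.mem_iUnion₂] at hx
    obtain ⟨t, ht, hx⟩ := hx
    have := dist_le_meshSize ht hx
    rw [← h0] at this
    rw [dist_le_zero.1 this]
    exact ht
  rw [measureReal_def, measure_mono_null hsub (S.finite_toSet.measure_zero _), ENNReal.toReal_zero]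

/-- The volume of the overlap of `T` and its translate `T - k`. -/
noncomputable def overlap (T : Set (EuclideanSpace ℝ (Fin d))) (k : EuclideanSpace ℝ (Fin d)) : ℝ :=
  volume.real (T ∩ (-k +ᵥ T))

theorem overlap_nonneg (T : Set (EuclideanSpace ℝ (Fin d))) (k : EuclideanSpace ℝ (Fin d)) :
    0 ≤ overlap T k := measureReal_nonneg

theorem mem_neg_vadd_iff (T : Set (EuclideanSpace ℝ (Fin d))) (k x : EuclideanSpace ℝ (Fin d)) :
    x ∈ -k +ᵥ T ↔ x + k ∈ T := by
  rw [Set.mem_vadd_set_iff_neg_vadd_mem, neg_neg, vadd_eq_add, add_comm]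

/-- For $y\in T$, the point $(1-\varepsilon)y+\varepsilon(z+\varepsilon^{-1}k)$ is the contracted
point moved by $k$, and it lies in $T$ by convexity. The contracted copy of $T$ is therefore
contained in both $T$ and $T-k$. -/
theorem homothety_image_subset {T : Set (EuclideanSpace ℝ (Fin d))} (hT : Convex ℝ T)
    {z k : EuclideanSpace ℝ (Fin d)} {R ε : ℝ} (hz : Metric.closedBall z R ⊆ T) (hR : 0 < R)
    (hε : 0 ≤ ε) (hε1 : ε ≤ 1) (hk : ‖k‖ ≤ ε * R) :
    AffineMap.homothety z (1 - ε) '' T ⊆ T ∩ (-k +ᵥ T) := by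
  have hmem : ∀ k : EuclideanSpace ℝ (Fin d), ‖k‖ ≤ ε * R → ∀ y ∈ T,
      AffineMap.homothety z (1 - ε) y + k ∈ T := by
    intro k hk y hy
    rcases hε.eq_or_lt with rfl | hpos
    · have : k = 0 := by simpa using hk
      simpa [this] using hy
    · have hw : z + ε⁻¹ • k ∈ T := by
        refine hz ?_
        rw [mem_closedBall_iff_norm, add_sub_cancel_left, norm_smul, Real.norm_of_nonneg (by positivity)]
        rw [inv_mul_le_iff₀ hpos]
        exact hk
      have h := hT hy hw (by linarith : 0 ≤ 1 - ε) hε (by ring)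
      convert h using 1
      rw [AffineMap.homothety_apply, vsub_eq_sub, vadd_eq_add, smul_add, smul_smul,
        mul_inv_cancel₀ hpos.ne', one_smul, smul_sub, sub_smul, sub_smul]
      module
  rintro _ ⟨y, hy, rfl⟩
  refine ⟨?_, (mem_neg_vadd_iff _ _ _).2 (hmem k hk y hy)⟩
  simpa using hmem 0 (by rw [norm_zero]; positivity) y hy

theorem overlap_ge {T : Set (EuclideanSpace ℝ (Fin d))} (hT : Convex ℝ T) (hTc : IsCompact T)
    {z k : EuclideanSpace ℝ (Fin d)} {R ε : ℝ} (hz : Metric.closedBall z R ⊆ T) (hR : 0 < R)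
    (hε : 0 ≤ ε) (hε1 : ε ≤ 1) (hk : ‖k‖ ≤ ε * R) :
    (1 - ε) ^ d * volume.real T ≤ overlap T k := by
  have h1 : volume.real (AffineMap.homothety z (1 - ε) '' T) = (1 - ε) ^ d * volume.real T := by
    rw [measureReal_def, Measure.addHaar_image_homothety, ENNReal.toReal_mul, finrank_euclideanSpace,
      Fintype.card_fin, ENNReal.toReal_ofReal (abs_nonneg _),
      abs_of_nonneg (pow_nonneg (by linarith) _)]
    rfl
  rw [← h1]
  exact measureReal_mono (homothety_image_subset hT hz hR hε hε1 hk)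
    ((measure_mono Set.inter_subset_left).trans_lt hTc.measure_lt_top).ne

/-- The overlap at $h$ exceeds that at $k$ by at most $|(T-h)\setminus(T-k)|=|T|-|T\cap(T-(k-h))|$.
The lower bound $(1-\varepsilon)^d|T|$ with $\varepsilon=\|h-k\|/R$ and Bernoulli's inequality bound
this by $d\varepsilon|T|$. -/
theorem overlap_sub_le {T : Set (EuclideanSpace ℝ (Fin d))} (hT : Convex ℝ T) (hTc : IsCompact T)
    {z h k : EuclideanSpace ℝ (Fin d)} {R : ℝ} (hz : Metric.closedBall z R ⊆ T) (hR : 0 < R)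
    (hhk : ‖h - k‖ ≤ R) :
    |overlap T h - overlap T k| ≤ d * (‖h - k‖ / R) * volume.real T := by
  have key : ∀ h k : EuclideanSpace ℝ (Fin d), ‖h - k‖ ≤ R →
      overlap T h - overlap T k ≤ d * (‖h - k‖ / R) * volume.real T := by
    intro h k hhk
    have hTm : ∀ v : EuclideanSpace ℝ (Fin d), MeasurableSet (v +ᵥ T) := fun v =>
      (hTc.vadd v).isClosed.measurableSet
    have hTf : ∀ v : EuclideanSpace ℝ (Fin d), volume (v +ᵥ T) ≠ ∞ := fun v =>
      (hTc.vadd v).measure_lt_top.ne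
    have h1 : overlap T h ≤ overlap T k + volume.real ((-h +ᵥ T) \ (-k +ᵥ T)) := by
      refine (measureReal_mono (s₂ := (T ∩ (-k +ᵥ T)) ∪ ((-h +ᵥ T) \ (-k +ᵥ T))) ?_ ?_).trans
        (measureReal_union_le _ _)
      · intro x hx
        by_cases hxk : x ∈ -k +ᵥ T
        · exact Or.inl ⟨hx.1, hxk⟩
        · exact Or.inr ⟨hx.2, hxk⟩
      · exact (measure_union_lt_top
          ((measure_mono Set.inter_subset_left).trans_lt hTc.measure_lt_top)
          ((measure_mono Set.sdiff_subset).trans_lt (hTf _).lt_top)).ne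
    have h2 : volume.real ((-h +ᵥ T) \ (-k +ᵥ T)) = volume.real (T \ (-(k - h) +ᵥ T)) := by
      have : (-h +ᵥ T) \ (-k +ᵥ T) = -h +ᵥ (T \ (-(k - h) +ᵥ T)) := by
        rw [Set.vadd_set_sdiff, vadd_vadd]
        congr 2
        abel
      rw [this, measureReal_def, measure_vadd, ← measureReal_def]
    have h3 : volume.real (T \ (-(k - h) +ᵥ T)) = volume.real T - overlap T (k - h) := by
      rw [eq_sub_iff_add_eq, add_comm]
      exact measureReal_inter_add_sdiff (hTm _) hTc.measure_lt_top.ne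
    have hε : ‖k - h‖ ≤ (‖h - k‖ / R) * R := by
      rw [div_mul_cancel₀ _ hR.ne', norm_sub_rev]
    have hε1 : ‖h - k‖ / R ≤ 1 := (div_le_one hR).2 hhk
    have hε0 : 0 ≤ ‖h - k‖ / R := by positivity
    have h4 := overlap_ge hT hTc hz hR hε0 hε1 hε
    have h5 : 1 - d * (‖h - k‖ / R) ≤ (1 - ‖h - k‖ / R) ^ d := by
      have := one_add_mul_le_pow (a := -(‖h - k‖ / R)) (by linarith) d
      simpa [sub_eq_add_neg] using this
    have h6 : 0 ≤ volume.real T := measureReal_nonneg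
    nlinarith [mul_le_mul_of_nonneg_right h5 h6]
  rw [abs_sub_le_iff]
  refine ⟨key h k hhk, ?_⟩
  rw [norm_sub_rev]
  exact key k h (by rwa [norm_sub_rev])

/-- A point $p$ of the small ball outside $A$ would be separated from $A$ by a hyperplane. Moving
$p$ by $r$ along the normal stays in the ball of radius $2r$, hence in $T$, but ends at distance at
least $r$ from $A$. -/
theorem closedBall_subset_of_hausdorffDist_lt {A T : Set (EuclideanSpace ℝ (Fin d))}
    (hA : Convex ℝ A) (hAc : IsCompact A) (hAn : A.Nonempty) (hT : Bornology.IsBounded T)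
    {z : EuclideanSpace ℝ (Fin d)} {r : ℝ} (hr : 0 < r) (hz : Metric.closedBall z (2 * r) ⊆ T)
    (hd : Metric.hausdorffDist A T < r) : Metric.closedBall z r ⊆ A := by
  intro p hp
  by_contra hpA
  obtain ⟨f, u, hfA, hfp⟩ := geometric_hahn_banach_closed_point hA hAc.isClosed hpA
  set v := (InnerProductSpace.toDual ℝ _).symm f with hv
  have hf : ∀ x, f x = inner ℝ v x := fun x => by rw [hv, InnerProductSpace.toDual_symm_apply]
  have hv0 : 0 < ‖v‖ := by
    rw [norm_pos_iff]
    intro h0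
    obtain ⟨a, ha⟩ := hAn
    have h1 := hfA a ha
    rw [hf, h0, inner_zero_left] at h1 hfp
    linarith
  have hq : p + (r / ‖v‖) • v ∈ T := by
    refine hz ?_
    rw [mem_closedBall_iff_norm] at hp ⊢
    calc ‖p + (r / ‖v‖) • v - z‖ = ‖(p - z) + (r / ‖v‖) • v‖ := by congr 1; abel
      _ ≤ ‖p - z‖ + ‖(r / ‖v‖) • v‖ := norm_add_le _ _
      _ ≤ r + r := by
          gcongr
          rw [norm_smul, Real.norm_of_nonneg (by positivity), div_mul_cancel₀ _ hv0.ne']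
      _ = 2 * r := by ring
  have hTn : T.Nonempty := ⟨_, hq⟩
  obtain ⟨a, ha, hqa⟩ := Metric.exists_dist_lt_of_hausdorffDist_lt' hq hd
    (Metric.hausdorffEDist_ne_top_of_nonempty_of_bounded hAn hTn hAc.isBounded hT)
  have h1 : inner ℝ v (p + (r / ‖v‖) • v - a) = f p - f a + r * ‖v‖ := by
    rw [inner_sub_right, inner_add_right, inner_smul_right, real_inner_self_eq_norm_sq, hf, hf]
    field_simp
    ring
  have h2 : inner ℝ v (p + (r / ‖v‖) • v - a) ≤ ‖v‖ * r := by
    refine (real_inner_le_norm _ _).trans ?_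
    gcongr
    rw [← dist_eq_norm, dist_comm]
    exact hqa.le
  have h3 := hfA a ha
  nlinarith

theorem SamplingDesign.exists_closedBall_subset {S : ℕ → Finset (EuclideanSpace ℝ (Fin d))}
    (hS : SamplingDesign S) : ∃ r : ℝ, 0 < r ∧ ∀ᶠ n in atTop, ∃ z,
      Metric.closedBall z (r * volume.real (region (S n)) ^ (1 / d : ℝ)) ⊆ region (S n) := by
  obtain ⟨T, hTb, -, ⟨z, hz⟩, hlim⟩ := hS.shape
  obtain ⟨ρ, hρ, hball⟩ := Metric.isOpen_iff.1 isOpen_interior z hz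
  have hr : 0 < ρ / 4 := by positivity
  refine ⟨ρ / 4, hr, ?_⟩
  filter_upwards [hlim.eventually_lt_const hr, hS.volume_tendsto.eventually_gt_atTop 0] with n hn hv
  set L := volume.real (region (S n)) ^ (1 / d : ℝ) with hL
  have hLpos : 0 < L := Real.rpow_pos_of_pos hv _
  have hne : (region (S n)).Nonempty := by
    by_contra h
    rw [Set.not_nonempty_iff_eq_empty] at h
    simp [h] at hv
  have hsub := closedBall_subset_of_hausdorffDist_lt ((convex_region (S n)).smul L⁻¹)
    ((isCompact_region (S n)).smul L⁻¹) hne.smul_set hTb hr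
    (fun x hx => interior_subset (hball (Metric.closedBall_subset_ball (by linarith) hx))) hn
  refine ⟨L • z, ?_⟩
  have h1 := Set.smul_set_mono (a := L) hsub
  rw [smul_inv_smul₀ hLpos.ne', smul_closedBall _ _ hr.le, Real.norm_of_nonneg hLpos.le] at h1
  rwa [mul_comm]

/-- In dimension $0$ the whole space has finite volume, so $|T_n|$ could not tend to infinity. -/
theorem SamplingDesign.dim_pos {S : ℕ → Finset (EuclideanSpace ℝ (Fin d))}
    (hS : SamplingDesign S) : 0 < d := by
  rcases Nat.eq_zero_or_pos d with rfl | h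
  · exfalso
    obtain ⟨n, hn⟩ := (hS.volume_tendsto.eventually_gt_atTop
      (volume.real (Set.univ : Set (EuclideanSpace ℝ (Fin 0))))).exists
    have hfin : (volume (Set.univ : Set (EuclideanSpace ℝ (Fin 0)))) ≠ ∞ :=
      (Set.finite_univ.isCompact).measure_lt_top.ne
    exact hn.not_ge (measureReal_mono (Set.subset_univ _) hfin)
  · exact h

end Geometry

/-! ### Regularity of the covariance and Riemann sums over cells -/

section Covariance

variable {d : ℕ} {H : Type*} [NormedAddCommGroup H] [InnerProductSpace ℂ H] [CompleteSpace H]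
  {ι : Type*} {b : HilbertBasis ι ℂ H} {C : EuclideanSpace ℝ (Fin d) → H →L[ℂ] H} {γ : ℝ}

theorem traceNorm_sub_le_oscillation (b : HilbertBasis ι ℂ H)
    (C : EuclideanSpace ℝ (Fin d) → H →L[ℂ] H) {δ : ℝ} {x y : EuclideanSpace ℝ (Fin d)}
    (h : dist y x ≤ δ) : traceNorm b (C y - C x) ≤ oscillation b C δ x :=
  le_iSup₂ (f := fun y (_ : y ∈ Metric.closedBall x δ) => traceNorm b (C y - C x)) y h

theorem enorm_le_traceNorm (b : HilbertBasis ι ℂ H) (T : H →L[ℂ] H) : ‖T‖ₑ ≤ traceNorm b T :=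
  (enorm_le_hsNorm b T).trans (hsNorm_le_traceNorm b T)

/-- The integrals of the oscillation at scales $\delta_k\to0$ vanish in the limit, so the infimum of
the oscillations is $0$ almost everywhere. This yields the measurability of $C$, which is not
assumed. -/
theorem CovarianceRegular.ae_continuousAt (hC : CovarianceRegular b C γ) :
    ∀ᵐ x, ContinuousAt C x := by
  obtain ⟨hγ, -, M, δ₀, hδ₀, hM⟩ := hC.holder
  set δ : ℕ → ℝ := fun k => δ₀ / (k + 1) with hδ
  have hδpos : ∀ k, 0 < δ k := fun k => by positivity
  have hδle : ∀ k, δ k ≤ δ₀ := fun k =>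
    div_le_self hδ₀.le (by linarith [(Nat.cast_nonneg k : (0 : ℝ) ≤ k)])
  have hδlim : Tendsto δ atTop (𝓝 0) := by
    simpa [hδ, div_eq_mul_inv] using tendsto_one_div_add_atTop_nhds_zero_nat.const_mul δ₀
  have hlim : Tendsto (fun k => ENNReal.ofReal (M * δ k ^ γ)) atTop (𝓝 0) := by
    have h1 := (hδlim.rpow_const (Or.inr hγ.le)).const_mul M
    rw [Real.zero_rpow hγ.ne', mul_zero] at h1
    simpa using ENNReal.tendsto_ofReal h1
  have hzero : ∫⁻ x, ⨅ k, oscillation b C (δ k) x = 0 := by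
    refine le_antisymm (ge_of_tendsto' hlim fun k => ?_) bot_le
    exact (lintegral_mono fun x => iInf_le _ k).trans (hM (δ k) (hδpos k) (hδle k)).2
  rw [lintegral_eq_zero_iff' (AEMeasurable.iInf fun k => (hM (δ k) (hδpos k) (hδle k)).1)] at hzero
  filter_upwards [hzero] with x hx
  rw [EMetric.continuousAt_iff]
  intro ε hε
  have h1 : ⨅ k, oscillation b C (δ k) x < ε := hx.trans_lt hε
  obtain ⟨k, hk⟩ := iInf_lt_iff.1 h1
  refine ⟨ENNReal.ofReal (δ k), ENNReal.ofReal_pos.2 (hδpos k), fun y hy => ?_⟩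
  have hy' : dist y x ≤ δ k := by
    rw [edist_dist] at hy
    exact ((ENNReal.ofReal_lt_ofReal_iff (hδpos k)).1 hy).le
  rw [edist_eq_enorm_sub]
  exact ((enorm_le_traceNorm b _).trans (traceNorm_sub_le_oscillation b C hy')).trans_lt hk

theorem CovarianceRegular.aestronglyMeasurable (hC : CovarianceRegular b C γ) :
    AEStronglyMeasurable C volume := by
  have hm := measurableSet_of_continuousAt C
  have hcont : ContinuousOn C {x | ContinuousAt C x} := fun x hx => ContinuousAt.continuousWithinAt hx
  have h := hcont.aestronglyMeasurable (μ := volume) hm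
  rwa [Measure.restrict_eq_self_of_ae_mem (s := {x | ContinuousAt C x}) hC.ae_continuousAt] at h

theorem CovarianceRegular.integrable_covariance (hC : CovarianceRegular b C γ) :
    Integrable C volume :=
  ⟨hC.aestronglyMeasurable,
    (lintegral_mono fun h => enorm_le_traceNorm b (C h)).trans_lt hC.integrable⟩

theorem sum_volume_cell_mul_le (S : Finset (EuclideanSpace ℝ (Fin d)))
    (c F : EuclideanSpace ℝ (Fin d) → ℝ≥0∞) (h : ∀ s ∈ S, ∀ y ∈ cell S s, c s ≤ F y) :
    ∑ s ∈ S, volume (cell S s) * c s ≤ ∫⁻ y in region S, F y := by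
  rw [restrict_region, lintegral_finsetSum_measure]
  refine Finset.sum_le_sum fun s hs => ?_
  rw [mul_comm, ← setLIntegral_const]
  exact setLIntegral_mono' (measurableSet_cell S s) fun y hy => h s hs y hy

/-- The total mass of the covariance and of its oscillation at scale `δ`. -/
noncomputable def covarianceMass (b : HilbertBasis ι ℂ H)
    (C : EuclideanSpace ℝ (Fin d) → H →L[ℂ] H) (δ : ℝ) : ℝ≥0∞ :=
  ∫⁻ x, 2 * (traceNorm b (C x) + oscillation b C δ x)

theorem crossNorm_le_of_dist_le (b : HilbertBasis ι ℂ H)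
    (C : EuclideanSpace ℝ (Fin d) → H →L[ℂ] H) {δ : ℝ} {x y : EuclideanSpace ℝ (Fin d)}
    (h : dist y x ≤ δ) :
    crossNorm b (C y) ≤ 2 * (traceNorm b (C x) + oscillation b C δ x) := by
  calc crossNorm b (C y) = crossNorm b (C x + (C y - C x)) := by rw [add_sub_cancel]
    _ ≤ 2 * traceNorm b (C x) + 2 * traceNorm b (C y - C x) :=
        (crossNorm_add_le b _ _).trans (add_le_add (crossNorm_le b _) (crossNorm_le b _))
    _ ≤ _ := by
        rw [← mul_add]
        gcongr
        exact traceNorm_sub_le_oscillation b C h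

/-- Within a cell, $s$ may be replaced by any $y$ at the cost of an oscillation term. Translation
and reflection invariance of Lebesgue measure then make the bound uniform in $t$. -/
theorem sum_cell_crossNorm_sub_left_le (b : HilbertBasis ι ℂ H)
    (C : EuclideanSpace ℝ (Fin d) → H →L[ℂ] H) (S : Finset (EuclideanSpace ℝ (Fin d)))
    (t : EuclideanSpace ℝ (Fin d)) :
    ∑ s ∈ S, volume (cell S s) * crossNorm b (C (t - s)) ≤ covarianceMass b C (meshSize S) := by
  refine (sum_volume_cell_mul_le S _
    (fun y => 2 * (traceNorm b (C (t - y)) + oscillation b C (meshSize S) (t - y))) ?_).trans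
    ((setLIntegral_le_lintegral _ _).trans_eq (lintegral_sub_left_eq_self
      (fun x => 2 * (traceNorm b (C x) + oscillation b C (meshSize S) x)) t))
  intro s hs y hy
  refine crossNorm_le_of_dist_le b C ?_
  rw [dist_sub_left, dist_comm]
  exact dist_le_meshSize hs hy

/-- Fubini after substituting $h=x-y$: for fixed $h$, the admissible $y$ fill $T\cap(T-h)$. -/
theorem integral_overlap {T : Set (EuclideanSpace ℝ (Fin d))} (hT : IsCompact T)
    {F : Type*} [NormedAddCommGroup F] [NormedSpace ℝ F] [CompleteSpace F]
    {G : EuclideanSpace ℝ (Fin d) → F} (hG : Integrable G) :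
    Integrable (fun y => ∫ x in T, G (x - y)) (volume.restrict T) ∧
      ∫ y in T, ∫ x in T, G (x - y) = ∫ h, overlap T h • G h := by
  have hTm := hT.isClosed.measurableSet
  have : IsFiniteMeasure (volume.restrict T) := ⟨by simpa using hT.measure_lt_top⟩
  set Φ : EuclideanSpace ℝ (Fin d) → EuclideanSpace ℝ (Fin d) → F :=
    fun y h => Set.indicator {h | y + h ∈ T} G h with hΦ
  have hint : Integrable (Function.uncurry Φ) ((volume.restrict T).prod volume) := by
    have h1 := (hG.comp_snd (volume.restrict T)).indicator
      (s := {p : EuclideanSpace ℝ (Fin d) × EuclideanSpace ℝ (Fin d) | p.1 + p.2 ∈ T})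
      ((measurable_fst.add measurable_snd) hTm)
    exact h1
  have hinner : ∀ y, ∫ h, Φ y h = ∫ x in T, G (x - y) := by
    intro y
    rw [← integral_indicator hTm, ← integral_add_left_eq_self (T.indicator fun x => G (x - y)) y]
    refine integral_congr_ae (ae_of_all _ fun h => ?_)
    by_cases hy : y + h ∈ T
    · simp [hΦ, hy]
    · simp [hΦ, hy]
  constructor
  · simp_rw [← hinner]
    exact hint.integral_prod_left
  · simp_rw [← hinner]
    rw [integral_integral_swap hint]
    refine integral_congr_ae (ae_of_all _ fun h => ?_)
    have h1 : ∀ y, Φ y h = Set.indicator {y | y + h ∈ T} (fun _ => G h) y := fun y => rfl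
    simp_rw [h1]
    have hm : MeasurableSet {y | y + h ∈ T} := (measurable_add_const h) hTm
    rw [integral_indicator hm, Measure.restrict_restrict hm, setIntegral_const]
    congr 2
    ext y
    rw [Set.mem_inter_iff, Set.mem_inter_iff, mem_neg_vadd_iff, and_comm]
    rfl

/-- A Riemann sum over pairs of Voronoi cells is close to the double integral. -/
theorem hsNorm_riemannSum_sub_le (b : HilbertBasis ι ℂ H)
    {S : Finset (EuclideanSpace ℝ (Fin d))} {G : EuclideanSpace ℝ (Fin d) → H →L[ℂ] H}
    (hG : Integrable G) (F : EuclideanSpace ℝ (Fin d) → ℝ≥0∞)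
    (hF : ∀ h h', dist h' h ≤ 2 * meshSize S → hsNorm b (G h' - G h) ≤ F h) :
    hsNorm b (∑ t ∈ S, ∑ s ∈ S, (volume.real (cell S t) * volume.real (cell S s)) • G (t - s) -
      ∫ h, overlap (region S) h • G h) ≤ volume (region S) * ∫⁻ h, F h := by
  obtain ⟨hint, heq⟩ := integral_overlap (isCompact_region S) hG
  have hcell : ∀ t y, IntegrableOn (fun x => G (x - y)) (cell S t) := fun t y =>
    (hG.comp_sub_right y).integrableOn
  have hsplit : ∀ y, ∫ x in region S, G (x - y) = ∑ t ∈ S, ∫ x in cell S t, G (x - y) := fun y => by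
    rw [restrict_region, integral_finsetSum_measure fun t _ => hcell t y]
  have hfin : ∀ t, IsFiniteMeasure ((volume : Measure (EuclideanSpace ℝ (Fin d))).restrict (cell S t)) :=
    fun t => ⟨by simpa using volume_cell_lt_top S t⟩
  have hint' : ∀ s, IntegrableOn (fun y => ∫ x in region S, G (x - y)) (cell S s) := fun s =>
    IntegrableOn.mono_set hint (cell_subset_region S s)
  -- Each term of the sum is the integral of a constant over a pair of cells, so the difference can
  -- be compared pointwise with $G(x-y)$. Both arguments move by at most the mesh, hence the factor
  -- $2$ in `hF`.
  have hdiff : ∑ t ∈ S, ∑ s ∈ S, (volume.real (cell S t) * volume.real (cell S s)) • G (t - s) -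
      ∫ h, overlap (region S) h • G h =
      ∑ s ∈ S, ∫ y in cell S s, ∑ t ∈ S, ∫ x in cell S t, (G (t - s) - G (x - y)) := by
    rw [← heq, restrict_region, integral_finsetSum_measure fun s _ => by
      rw [← restrict_region]; exact hint' s, Finset.sum_comm, ← Finset.sum_sub_distrib]
    refine Finset.sum_congr rfl fun s _ => ?_
    have h1 : ∀ y, ∑ t ∈ S, ∫ x in cell S t, (G (t - s) - G (x - y)) =
        ∑ t ∈ S, volume.real (cell S t) • G (t - s) - ∫ x in region S, G (x - y) := by
      intro y
      rw [hsplit, ← Finset.sum_sub_distrib]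
      refine Finset.sum_congr rfl fun t _ => ?_
      rw [integral_sub (integrable_const _) (hcell t y), setIntegral_const]
    simp_rw [h1]
    rw [integral_sub (integrable_const _) (hint' s), setIntegral_const, Finset.smul_sum,
      ← restrict_region]
    congr 1
    exact Finset.sum_congr rfl fun t _ => by rw [smul_smul, mul_comm]
  rw [hdiff]
  calc hsNorm b (∑ s ∈ S, ∫ y in cell S s, ∑ t ∈ S, ∫ x in cell S t, (G (t - s) - G (x - y)))
      ≤ ∑ s ∈ S, ∫⁻ y in cell S s, ∑ t ∈ S, ∫⁻ x in cell S t, hsNorm b (G (t - s) - G (x - y)) := by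
        refine (hsNorm_sum_le b _ _).trans (Finset.sum_le_sum fun s _ => ?_)
        refine (hsNorm_integral_le b _ _).trans (lintegral_mono fun y => ?_)
        refine (hsNorm_sum_le b _ _).trans (Finset.sum_le_sum fun t _ => ?_)
        exact hsNorm_integral_le b _ _
    _ ≤ ∑ s ∈ S, ∫⁻ y in cell S s, ∑ t ∈ S, ∫⁻ x in cell S t, F (x - y) := by
        refine Finset.sum_le_sum fun s hs => setLIntegral_mono' (measurableSet_cell S s) fun y hy =>
          Finset.sum_le_sum fun t ht => setLIntegral_mono' (measurableSet_cell S t) fun x hx => ?_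
        refine hF _ _ ?_
        have h1 := dist_le_meshSize hs hy
        have h2 := dist_le_meshSize ht hx
        rw [dist_comm] at h1 h2
        calc dist (t - s) (x - y) ≤ dist t x + dist s y := dist_sub_sub_le _ _ _ _
          _ ≤ 2 * meshSize S := by linarith
    _ ≤ ∑ s ∈ S, ∫⁻ _y in cell S s, ∫⁻ h, F h := by
        refine Finset.sum_le_sum fun s hs => lintegral_mono fun y => ?_
        rw [← lintegral_finsetSum_measure, ← restrict_region]
        exact (setLIntegral_le_lintegral _ _).trans_eq (lintegral_sub_right_eq_self F y)
    _ = volume (region S) * ∫⁻ h, F h := by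
        simp_rw [setLIntegral_const]
        rw [← Finset.mul_sum, sum_volume_cell, mul_comm]

end Covariance

/-! ### Bounds for the lag weight -/

section Window

variable {d : ℕ}

theorem norm_character (θ h : EuclideanSpace ℝ (Fin d)) : ‖character θ h‖ = 1 := by
  rw [character, mul_comm, Complex.norm_exp_ofReal_mul_I]

theorem continuous_character (θ : EuclideanSpace ℝ (Fin d)) : Continuous (character θ) := by
  unfold character
  fun_prop

theorem norm_character_sub_le (θ h h' : EuclideanSpace ℝ (Fin d)) :
    ‖character θ h' - character θ h‖ ≤ ‖h' - h‖ * ‖θ‖ := by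
  have h1 : character θ h' - character θ h = character θ h * (character θ (h' - h) - 1) := by
    rw [character, character, character, mul_sub, ← Complex.exp_add, mul_one, inner_sub_left]
    congr 2
    push_cast
    ring
  rw [h1, norm_mul, norm_character, one_mul]
  exact Real.norm_exp_I_mul_ofReal_sub_one_le.trans (norm_inner_le_norm _ _)

/-- The weight `exp(i hᵀθ) K(h/Δ) / |T ∩ (T - h)|` of the lag `h`. -/
noncomputable def lagWeight (T : Set (EuclideanSpace ℝ (Fin d))) (K : EuclideanSpace ℝ (Fin d) → ℝ)
    (Δ : ℝ) (θ h : EuclideanSpace ℝ (Fin d)) : ℂ :=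
  character θ h * ((K (Δ⁻¹ • h) / overlap T h : ℝ) : ℂ)

/-- A sampling region whose inradius is large compared with the bandwidth. -/
structure AdmissibleWindow (T : Set (EuclideanSpace ℝ (Fin d))) (K : EuclideanSpace ℝ (Fin d) → ℝ)
    (L : ℝ≥0) (ρ Δ R : ℝ) : Prop where
  convex : Convex ℝ T
  compact : IsCompact T
  ball : ∃ z, Metric.closedBall z R ⊆ T
  volume_pos : 0 < volume.real T
  one_le_radius : 1 ≤ R
  one_le_bandwidth : 1 ≤ Δ
  fit : ρ * Δ ≤ R / 4
  support : ∀ u, K u ≠ 0 → ‖u‖ ≤ ρ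
  lipschitz : LipschitzWith L K
  nonneg : ∀ u, 0 ≤ K u
  le_one : ∀ u, K u ≤ 1

variable {T : Set (EuclideanSpace ℝ (Fin d))} {K : EuclideanSpace ℝ (Fin d) → ℝ}
    {L : ℝ≥0} {ρ Δ R : ℝ}

namespace AdmissibleWindow

theorem norm_le (hw : AdmissibleWindow T K L ρ Δ R) {h : EuclideanSpace ℝ (Fin d)}
    (hh : K (Δ⁻¹ • h) ≠ 0) : ‖h‖ ≤ ρ * Δ := by
  have hΔ : 0 < Δ := by linarith [hw.one_le_bandwidth]
  have h1 := hw.support _ hh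
  rwa [norm_smul, norm_inv, Real.norm_of_nonneg hΔ.le, inv_mul_le_iff₀ hΔ, mul_comm] at h1

theorem overlap_ge (hw : AdmissibleWindow T K L ρ Δ R) {h : EuclideanSpace ℝ (Fin d)}
    (hh : ‖h‖ ≤ R / 2) : (1 / 2) ^ d * volume.real T ≤ overlap T h := by
  obtain ⟨z, hz⟩ := hw.ball
  have := SpectralRKHS.overlap_ge hw.convex hw.compact (k := h) (ε := 1 / 2) hz
    (by linarith [hw.one_le_radius]) (by norm_num) (by norm_num) (by linarith)
  norm_num at this ⊢
  exact this

theorem overlap_pos (hw : AdmissibleWindow T K L ρ Δ R) {h : EuclideanSpace ℝ (Fin d)}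
    (hh : ‖h‖ ≤ R / 2) : 0 < overlap T h :=
  lt_of_lt_of_le (mul_pos (by positivity) hw.volume_pos) (hw.overlap_ge hh)

theorem inv_overlap_le (hw : AdmissibleWindow T K L ρ Δ R) {h : EuclideanSpace ℝ (Fin d)}
    (hh : ‖h‖ ≤ R / 2) : (overlap T h)⁻¹ ≤ 2 ^ d / volume.real T := by
  have h1 := hw.overlap_ge hh
  have h2 : 0 < (1 / 2 : ℝ) ^ d * volume.real T := mul_pos (by positivity) hw.volume_pos
  calc (overlap T h)⁻¹ ≤ ((1 / 2 : ℝ) ^ d * volume.real T)⁻¹ := inv_anti₀ h2 h1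
    _ = 2 ^ d / volume.real T := by
        rw [mul_inv, ← inv_pow, one_div, inv_inv, div_eq_mul_inv]

theorem norm_le_half (hw : AdmissibleWindow T K L ρ Δ R) {h : EuclideanSpace ℝ (Fin d)}
    (hh : K (Δ⁻¹ • h) ≠ 0) : ‖h‖ ≤ R / 2 := by
  linarith [hw.norm_le hh, hw.fit, hw.one_le_radius]

theorem norm_lagWeight (hw : AdmissibleWindow T K L ρ Δ R) (θ h : EuclideanSpace ℝ (Fin d)) :
    ‖lagWeight T K Δ θ h‖ = K (Δ⁻¹ • h) * (overlap T h)⁻¹ := by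
  rw [lagWeight, norm_mul, norm_character, one_mul, Complex.norm_real, Real.norm_of_nonneg
    (div_nonneg (hw.nonneg _) (overlap_nonneg _ _)), div_eq_mul_inv]

theorem norm_lagWeight_le (hw : AdmissibleWindow T K L ρ Δ R) (θ h : EuclideanSpace ℝ (Fin d)) :
    ‖lagWeight T K Δ θ h‖ ≤ 2 ^ d / volume.real T := by
  rw [hw.norm_lagWeight]
  by_cases hh : K (Δ⁻¹ • h) = 0
  · rw [hh, zero_mul]
    exact div_nonneg (by positivity) hw.volume_pos.le
  · exact (mul_le_of_le_one_left (inv_nonneg.2 (overlap_nonneg _ _)) (hw.le_one _)).trans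
      (hw.inv_overlap_le (hw.norm_le_half hh))

theorem lagWeight_eq_zero (hw : AdmissibleWindow T K L ρ Δ R) {θ h : EuclideanSpace ℝ (Fin d)}
    (hh : ρ * Δ < ‖h‖) : lagWeight T K Δ θ h = 0 := by
  have h1 : K (Δ⁻¹ • h) = 0 := by
    by_contra h0
    exact hh.not_ge (hw.norm_le h0)
  simp [lagWeight, h1]

theorem abs_kernel_sub_le (hw : AdmissibleWindow T K L ρ Δ R) (h h' : EuclideanSpace ℝ (Fin d)) :
    |K (Δ⁻¹ • h') - K (Δ⁻¹ • h)| ≤ L * ‖h' - h‖ := by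
  have hΔ : 0 < Δ := by linarith [hw.one_le_bandwidth]
  have h1 := hw.lipschitz.dist_le_mul (Δ⁻¹ • h') (Δ⁻¹ • h)
  rw [Real.dist_eq, dist_eq_norm, ← smul_sub, norm_smul, norm_inv, Real.norm_of_nonneg hΔ.le] at h1
  refine h1.trans ?_
  gcongr
  exact mul_le_of_le_one_left (norm_nonneg _) (inv_le_one_of_one_le₀ hw.one_le_bandwidth)

/-- A product rule for three factors: the character is $\|\theta\|$-Lipschitz, the rescaled kernel
$L$-Lipschitz since $\Delta\ge1$, and the reciprocal overlap changes by at most $d\|h'-h\||T|$ times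
$(2^d/|T|)^2$, which produces $4^dd$. -/
theorem norm_lagWeight_sub_le (hw : AdmissibleWindow T K L ρ Δ R)
    {θ h h' : EuclideanSpace ℝ (Fin d)} (hd : ‖h' - h‖ ≤ R / 4) :
    ‖lagWeight T K Δ θ h' - lagWeight T K Δ θ h‖ ≤
      ‖h' - h‖ * (2 ^ d * ‖θ‖ + 2 ^ d * L + 4 ^ d * d) / volume.real T := by
  have hV := hw.volume_pos
  have hR := hw.one_le_radius
  by_cases hK : K (Δ⁻¹ • h) = 0 ∧ K (Δ⁻¹ • h') = 0
  · simp only [lagWeight, hK.1, hK.2]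
    simp only [zero_div, Complex.ofReal_zero, mul_zero, sub_zero, norm_zero]
    positivity
  -- One of the two lags lies in the support, hence within $\rho\Delta\le R/4$, and the other is at
  -- most $R/4$ away.
  have hsmall : ‖h‖ ≤ R / 2 ∧ ‖h'‖ ≤ R / 2 := by
    have hfit := hw.fit
    have e1 : ‖h‖ ≤ ‖h'‖ + ‖h' - h‖ := by
      have := norm_sub_le h' (h' - h)
      simpa using this
    have e2 : ‖h'‖ ≤ ‖h‖ + ‖h' - h‖ := by
      have := norm_add_le h (h' - h)
      simpa using this
    by_cases hh : K (Δ⁻¹ • h) = 0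
    · have := hw.norm_le fun h0 => hK ⟨hh, h0⟩
      constructor <;> linarith
    · have := hw.norm_le hh
      constructor <;> linarith
  set k := K (Δ⁻¹ • h)
  set k' := K (Δ⁻¹ • h')
  set g := overlap T h
  set g' := overlap T h'
  set V := volume.real T
  set δ := ‖h' - h‖ with hδ
  have hg : 0 < g := hw.overlap_pos hsmall.1
  have hg' : 0 < g' := hw.overlap_pos hsmall.2
  have hgi : g⁻¹ ≤ 2 ^ d / V := hw.inv_overlap_le hsmall.1
  have hgi' : g'⁻¹ ≤ 2 ^ d / V := hw.inv_overlap_le hsmall.2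
  have hgg : |g' - g| ≤ d * δ * V := by
    obtain ⟨z, hz⟩ := hw.ball
    refine (overlap_sub_le hw.convex hw.compact hz (by linarith) (by linarith)).trans ?_
    gcongr
    exact div_le_self (norm_nonneg _) hR
  have hkk : |k' - k| ≤ L * δ := hw.abs_kernel_sub_le h h'
  have hk0 : 0 ≤ k := hw.nonneg _
  have hk1 : k ≤ 1 := hw.le_one _
  have hreal : |k' / g' - k / g| ≤ δ * (2 ^ d * L + 4 ^ d * d) / V := by
    have e1 : k' / g' - k / g = (k' - k) * g'⁻¹ + k * ((g - g') * (g⁻¹ * g'⁻¹)) := by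
      field_simp
      ring
    have e2 : |(k' - k) * g'⁻¹| ≤ (L * δ) * (2 ^ d / V) := by
      rw [abs_mul, abs_of_pos (inv_pos.2 hg')]
      gcongr
    have e3 : |k * ((g - g') * (g⁻¹ * g'⁻¹))| ≤ 1 * ((d * δ * V) * ((2 ^ d / V) * (2 ^ d / V))) := by
      rw [abs_mul, abs_mul, abs_of_nonneg hk0,
        abs_of_pos (mul_pos (inv_pos.2 hg) (inv_pos.2 hg')), abs_sub_comm]
      gcongr
    rw [e1]
    refine (abs_add_le _ _).trans ((add_le_add e2 e3).trans_eq ?_)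
    have : (4 : ℝ) ^ d = 2 ^ d * 2 ^ d := by rw [← mul_pow]; norm_num
    rw [this]
    field_simp
  have hsplit : lagWeight T K Δ θ h' - lagWeight T K Δ θ h =
      (character θ h' - character θ h) * ((k / g : ℝ) : ℂ) +
        character θ h' * ((k' / g' - k / g : ℝ) : ℂ) := by
    simp only [lagWeight]
    push_cast
    ring
  rw [hsplit]
  have e4 : ‖(character θ h' - character θ h) * ((k / g : ℝ) : ℂ)‖ ≤ (δ * ‖θ‖) * (2 ^ d / V) := by
    rw [norm_mul, Complex.norm_real, Real.norm_of_nonneg (div_nonneg hk0 hg.le), div_eq_mul_inv]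
    gcongr
    · exact norm_character_sub_le θ h h'
    · exact (mul_le_of_le_one_left (inv_pos.2 hg).le hk1).trans hgi
  have e5 : ‖character θ h' * ((k' / g' - k / g : ℝ) : ℂ)‖ ≤ δ * (2 ^ d * L + 4 ^ d * d) / V := by
    rw [norm_mul, norm_character, one_mul, Complex.norm_real, Real.norm_eq_abs]
    exact hreal
  refine (norm_add_le _ _).trans ((add_le_add e4 e5).trans_eq ?_)
  field_simp
  ring

theorem continuous_overlap (hw : AdmissibleWindow T K L ρ Δ R) : Continuous (overlap T) := by
  obtain ⟨z, hz⟩ := hw.ball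
  have hR : 0 < R := by linarith [hw.one_le_radius]
  rw [continuous_iff_continuousAt]
  intro h
  rw [ContinuousAt, tendsto_iff_norm_sub_tendsto_zero]
  have hlim : Tendsto (fun k => d * (‖k - h‖ / R) * volume.real T) (𝓝 h) (𝓝 0) := by
    have h1 : Continuous fun k : EuclideanSpace ℝ (Fin d) => d * (‖k - h‖ / R) * volume.real T := by
      fun_prop
    simpa using h1.tendsto h
  refine squeeze_zero' (Eventually.of_forall fun k => norm_nonneg _) ?_ hlim
  filter_upwards [Metric.closedBall_mem_nhds h hR] with k hk
  exact overlap_sub_le hw.convex hw.compact hz hR (mem_closedBall_iff_norm.1 hk)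

theorem measurable_lagWeight (hw : AdmissibleWindow T K L ρ Δ R) (θ : EuclideanSpace ℝ (Fin d)) :
    Measurable (lagWeight T K Δ θ) := by
  have h1 := hw.continuous_overlap.measurable
  have h2 := (continuous_character θ).measurable
  have h3 : Measurable fun h : EuclideanSpace ℝ (Fin d) => K (Δ⁻¹ • h) :=
    (hw.lipschitz.continuous.comp (continuous_const_smul _)).measurable
  exact h2.mul (Complex.measurable_ofReal.comp (h3.div h1))

end AdmissibleWindow

end Window

/-! ### Discretization and smoothing bias -/

section Bias

variable {d : ℕ} {H : Type*} [NormedAddCommGroup H] [InnerProductSpace ℂ H] [CompleteSpace H]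
  {ι : Type*} {b : HilbertBasis ι ℂ H} {C : EuclideanSpace ℝ (Fin d) → H →L[ℂ] H} {γ : ℝ}
  {K : EuclideanSpace ℝ (Fin d) → ℝ} {L : ℝ≥0} {ρ Δ R : ℝ}

theorem enorm_le_ofReal {F : Type*} [SeminormedAddCommGroup F] {x : F} {c : ℝ} (h : ‖x‖ ≤ c) :
    ‖x‖ₑ ≤ ENNReal.ofReal c := by
  rw [← ofReal_norm]
  exact ENNReal.ofReal_le_ofReal h

theorem AdmissibleWindow.integral_overlap_smul {T : Set (EuclideanSpace ℝ (Fin d))}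
    (hw : AdmissibleWindow T K L ρ Δ R) (θ : EuclideanSpace ℝ (Fin d)) :
    ∫ h, overlap T h • lagWeight T K Δ θ h • C h =
      ∫ h, (character θ h * (K (Δ⁻¹ • h) : ℂ)) • C h := by
  refine integral_congr_ae (ae_of_all _ fun h => ?_)
  change overlap T h • lagWeight T K Δ θ h • C h = _
  -- The overlap may be cancelled only where it is known to be positive, which holds on the support
  -- of the kernel; elsewhere both sides vanish.
  by_cases hh : K (Δ⁻¹ • h) = 0
  · simp [lagWeight, hh]
  · have h1 := (hw.overlap_pos (hw.norm_le_half hh)).ne'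
    rw [← Complex.coe_smul, smul_smul, lagWeight]
    congr 1
    push_cast
    have h2 : ((overlap T h : ℝ) : ℂ) ≠ 0 := by exact_mod_cast h1
    field_simp

/-- The oscillation of weight times covariance is split as $(w'-w)C+w'(C'-C)$. Both weight bounds
carry $1/|T|$, which cancels the factor $|T|$ of the Riemann sum estimate. -/
theorem AdmissibleWindow.hsNorm_discretization_le {S : Finset (EuclideanSpace ℝ (Fin d))}
    (hw : AdmissibleWindow (region S) K L ρ Δ R) (hC : CovarianceRegular b C γ)
    (hmesh : 2 * meshSize S ≤ R / 4)
    (hosc : AEMeasurable (oscillation b C (2 * meshSize S)) volume)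
    (θ : EuclideanSpace ℝ (Fin d)) :
    hsNorm b (∑ t ∈ S, ∑ s ∈ S, (volume.real (cell S t) * volume.real (cell S s)) •
        lagWeight (region S) K Δ θ (t - s) • C (t - s) -
      ∫ h, (character θ h * (K (Δ⁻¹ • h) : ℂ)) • C h) ≤
    ENNReal.ofReal (2 ^ d) * (∫⁻ x, oscillation b C (2 * meshSize S) x) +
      ENNReal.ofReal (2 * meshSize S * (2 ^ d * ‖θ‖ + 2 ^ d * L + 4 ^ d * d)) *
        ∫⁻ x, traceNorm b (C x) := by
  set V := volume.real (region S) with hV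
  have hVpos : 0 < V := hw.volume_pos
  set A := 2 ^ d * ‖θ‖ + 2 ^ d * L + 4 ^ d * d with hA
  have hA0 : 0 ≤ A := by positivity
  have hδ0 := meshSize_nonneg S
  have hG : Integrable (fun h => lagWeight (region S) K Δ θ h • C h) :=
    hC.integrable_covariance.bdd_smul (2 ^ d / V) (hw.measurable_lagWeight θ).aestronglyMeasurable
      (ae_of_all _ fun h => hw.norm_lagWeight_le θ h)
  have key := hsNorm_riemannSum_sub_le b (S := S) hG
    (fun h => ENNReal.ofReal (2 * meshSize S * A / V) * traceNorm b (C h) +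
      ENNReal.ofReal (2 ^ d / V) * oscillation b C (2 * meshSize S) h) ?_
  · rw [hw.integral_overlap_smul] at key
    refine key.trans_eq ?_
    rw [lintegral_add_right' _ (hosc.const_mul _), lintegral_const_mul' _ _ ENNReal.ofReal_ne_top,
      lintegral_const_mul' _ _ ENNReal.ofReal_ne_top, mul_add, ← mul_assoc, ← mul_assoc]
    have hvol : volume (region S) = ENNReal.ofReal V := by
      rw [hV, measureReal_def, ENNReal.ofReal_toReal (isCompact_region S).measure_lt_top.ne]
    rw [hvol, ← ENNReal.ofReal_mul hVpos.le, ← ENNReal.ofReal_mul hVpos.le,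
      mul_div_cancel₀ _ hVpos.ne', mul_div_cancel₀ _ hVpos.ne', add_comm]
  · intro h h' hh
    have hh' : ‖h' - h‖ ≤ 2 * meshSize S := by rwa [← dist_eq_norm]
    have hsplit : lagWeight (region S) K Δ θ h' • C h' - lagWeight (region S) K Δ θ h • C h =
        (lagWeight (region S) K Δ θ h' - lagWeight (region S) K Δ θ h) • C h +
          lagWeight (region S) K Δ θ h' • (C h' - C h) := by
      rw [sub_smul, smul_sub]
      abel
    rw [hsplit]
    refine (hsNorm_add_le b _ _).trans ?_
    rw [hsNorm_smul, hsNorm_smul]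
    gcongr
    · refine enorm_le_ofReal ((hw.norm_lagWeight_sub_le (hh'.trans hmesh)).trans ?_)
      gcongr
    · exact hsNorm_le_traceNorm b _
    · exact enorm_le_ofReal (hw.norm_lagWeight_le θ h')
    · exact (hsNorm_le_traceNorm b _).trans (traceNorm_sub_le_oscillation b C hh)

/-- The difference is minus the integral of $e^{ih^\top\theta}(1-K(h/\Delta))C(h)$. Off $\Delta S_K$
the factor $1-K$ equals $1$, so splitting the domain gives precisely the two bias operators. -/
theorem KernelRegular.hsNorm_smoothing_le (hK : KernelRegular K) (hC : CovarianceRegular b C γ)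
    (hΔ : 0 < Δ) (θ : EuclideanSpace ℝ (Fin d)) :
    hsNorm b ((∫ h, (character θ h * (K (Δ⁻¹ • h) : ℂ)) • C h) - ∫ h, character θ h • C h) ≤
      ENNReal.ofReal (biasB1 b C K Δ θ + biasB2 b C K Δ θ) := by
  set A := Δ • kernelSupport K with hA
  have hAm : MeasurableSet A := by
    have : IsOpen (kernelSupport K) := isOpen_lt continuous_const hK.continuous
    exact (this.smul₀ hΔ.ne').measurableSet
  have hKc : Continuous fun h : EuclideanSpace ℝ (Fin d) => K (Δ⁻¹ • h) :=
    hK.continuous.comp (continuous_const_smul _)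
  have hint := hC.integrable_covariance
  have hchar : Integrable (fun h => character θ h • C h) :=
    hint.bdd_smul 1 (continuous_character θ).aestronglyMeasurable
      (ae_of_all _ fun h => (norm_character θ h).le)
  have hnorm1 : ∀ h, ‖character θ h * ((1 - K (Δ⁻¹ • h) : ℝ) : ℂ)‖ ≤ 1 := fun h => by
    rw [norm_mul, norm_character, one_mul, Complex.norm_real, Real.norm_eq_abs, abs_le]
    constructor <;> linarith [hK.nonneg (Δ⁻¹ • h), hK.le_one (Δ⁻¹ • h)]
  have hone : Integrable (fun h => (character θ h * ((1 - K (Δ⁻¹ • h) : ℝ) : ℂ)) • C h) := by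
    refine hint.bdd_smul 1 (Continuous.aestronglyMeasurable ?_) (ae_of_all _ hnorm1)
    exact (continuous_character θ).mul (Complex.continuous_ofReal.comp (continuous_const.sub hKc))
  have hdiff : (∫ h, (character θ h * (K (Δ⁻¹ • h) : ℂ)) • C h) - ∫ h, character θ h • C h =
      -((∫ h in A, (character θ h * ((1 - K (Δ⁻¹ • h) : ℝ) : ℂ)) • C h) +
        ∫ h in Aᶜ, character θ h • C h) := by
    have h1 : ∫ h in Aᶜ, character θ h • C h =
        ∫ h in Aᶜ, (character θ h * ((1 - K (Δ⁻¹ • h) : ℝ) : ℂ)) • C h := by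
      refine setIntegral_congr_fun hAm.compl fun h hh => ?_
      have h0 : K (Δ⁻¹ • h) = 0 := by
        refine le_antisymm (not_lt.1 fun hpos => hh ?_) (hK.nonneg _)
        exact (Set.mem_smul_set_iff_inv_smul_mem₀ hΔ.ne' _ _).2 hpos
      simp [h0]
    have h2 : ∀ h, (character θ h * (K (Δ⁻¹ • h) : ℂ)) • C h =
        character θ h • C h - (character θ h * ((1 - K (Δ⁻¹ • h) : ℝ) : ℂ)) • C h := fun h => by
      rw [← sub_smul]
      congr 1
      push_cast
      ring
    rw [h1, integral_add_compl hAm hone]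
    simp_rw [h2]
    rw [integral_sub hchar hone, sub_sub_cancel_left]
  -- Finiteness is needed because `biasB1` and `biasB2` apply `toReal`, which would send $\infty$ to
  -- $0$.
  have hfin : ∀ (B : Set (EuclideanSpace ℝ (Fin d))) (w : EuclideanSpace ℝ (Fin d) → ℂ),
      (∀ h, ‖w h‖ ≤ 1) → hsNorm b (∫ h in B, w h • C h) ≠ ∞ := by
    intro B w hw
    refine ne_top_of_le_ne_top hC.integrable.ne ((hsNorm_integral_le b _ _).trans
      ((setLIntegral_le_lintegral _ _).trans (lintegral_mono fun h => ?_)))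
    rw [hsNorm_smul]
    refine (mul_le_mul' (enorm_le_ofReal (hw h)) (hsNorm_le_traceNorm b _)).trans_eq ?_
    simp
  rw [hdiff, hsNorm_neg]
  refine (hsNorm_add_le b _ _).trans_eq ?_
  rw [biasB1, biasB2, ENNReal.ofReal_add ENNReal.toReal_nonneg ENNReal.toReal_nonneg,
    ENNReal.ofReal_toReal (hfin _ _ hnorm1),
    ENNReal.ofReal_toReal (hfin _ _ fun h => (norm_character θ h).le)]

end Bias

/-! ### Variance of the estimator -/

section Variance

variable {d : ℕ} {H : Type*} [NormedAddCommGroup H] [InnerProductSpace ℂ H] [CompleteSpace H]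
  {ι : Type*} {b : HilbertBasis ι ℂ H} {C : EuclideanSpace ℝ (Fin d) → H →L[ℂ] H} {γ : ℝ}
  {K : EuclideanSpace ℝ (Fin d) → ℝ} {L : ℝ≥0} {ρ Δ R : ℝ}
  {S : Finset (EuclideanSpace ℝ (Fin d))}

/-- The coefficient of `X(t) ⊗ X(s)` in the lag-window estimator, up to the factor `(2π)⁻ᵈ`. -/
noncomputable def pairWeight (S : Finset (EuclideanSpace ℝ (Fin d)))
    (K : EuclideanSpace ℝ (Fin d) → ℝ) (Δ : ℝ) (θ : EuclideanSpace ℝ (Fin d))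
    (p : EuclideanSpace ℝ (Fin d) × EuclideanSpace ℝ (Fin d)) : ℂ :=
  ((volume.real (cell S p.1) * volume.real (cell S p.2) : ℝ) : ℂ) *
    lagWeight (region S) K Δ θ (p.1 - p.2)

theorem enorm_volume_cell (S : Finset (EuclideanSpace ℝ (Fin d)))
    (t : EuclideanSpace ℝ (Fin d)) : ‖volume.real (cell S t)‖ₑ = volume (cell S t) := by
  rw [Real.enorm_of_nonneg measureReal_nonneg, measureReal_def,
    ENNReal.ofReal_toReal (volume_cell_lt_top S t).ne]

theorem AdmissibleWindow.enorm_pairWeight_le (hw : AdmissibleWindow (region S) K L ρ Δ R)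
    (θ : EuclideanSpace ℝ (Fin d)) (p : EuclideanSpace ℝ (Fin d) × EuclideanSpace ℝ (Fin d)) :
    ‖pairWeight S K Δ θ p‖ₑ ≤ volume (cell S p.1) * volume (cell S p.2) *
      (ENNReal.ofReal (2 ^ d / volume.real (region S)) *
        (Metric.closedBall p.1 (ρ * Δ)).indicator 1 p.2) := by
  have h1 : ‖((volume.real (cell S p.1) * volume.real (cell S p.2) : ℝ) : ℂ)‖ₑ =
      volume (cell S p.1) * volume (cell S p.2) := by
    rw [← ofReal_norm, Complex.norm_real, ofReal_norm, enorm_mul, enorm_volume_cell,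
      enorm_volume_cell]
  rw [pairWeight, enorm_mul, h1]
  gcongr
  by_cases hp : p.2 ∈ Metric.closedBall p.1 (ρ * Δ)
  · rw [Set.indicator_of_mem hp, Pi.one_apply, mul_one]
    exact enorm_le_ofReal (hw.norm_lagWeight_le θ _)
  · rw [hw.lagWeight_eq_zero, enorm_zero]
    · exact bot_le
    · rw [Metric.mem_closedBall, not_le, dist_comm, dist_eq_norm] at hp
      exact hp

/-- For fixed $t$, the cells of the contributing $s$ lie in a ball of radius $(\rho+1)\Delta$, as
the mesh is at most $\Delta$. Summing over $t$ yields $|T|$, which cancels the denominator. -/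
theorem AdmissibleWindow.sum_enorm_pairWeight_le (hw : AdmissibleWindow (region S) K L ρ Δ R)
    (hρ : 0 ≤ ρ) (hmesh : meshSize S ≤ Δ) (θ : EuclideanSpace ℝ (Fin d)) :
    ∑ p ∈ S ×ˢ S, ‖pairWeight S K Δ θ p‖ₑ ≤ ENNReal.ofReal (2 ^ d) *
      (ENNReal.ofReal (((ρ + 1) * Δ) ^ d) * volume (Metric.ball (0 : EuclideanSpace ℝ (Fin d)) 1)) := by
  have hΔ : 0 ≤ (ρ + 1) * Δ := mul_nonneg (by linarith) (by linarith [hw.one_le_bandwidth])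
  have hball : ∀ t, ∑ s ∈ S, volume (cell S s) *
      (Metric.closedBall t (ρ * Δ)).indicator 1 s ≤
        ENNReal.ofReal (((ρ + 1) * Δ) ^ d) *
          volume (Metric.ball (0 : EuclideanSpace ℝ (Fin d)) 1) := by
    intro t
    refine (sum_volume_cell_mul_le S _ ((Metric.closedBall t ((ρ + 1) * Δ)).indicator 1) ?_).trans ?_
    · intro s hs y hy
      by_cases hst : s ∈ Metric.closedBall t (ρ * Δ)
      · have hyt : y ∈ Metric.closedBall t ((ρ + 1) * Δ) := by
          rw [Metric.mem_closedBall] at hst ⊢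
          linarith [dist_triangle y s t, dist_le_meshSize hs hy]
        rw [Set.indicator_of_mem hst, Set.indicator_of_mem hyt, Pi.one_apply, Pi.one_apply]
      · rw [Set.indicator_of_notMem hst]
        exact bot_le
    · refine (setLIntegral_le_lintegral _ _).trans_eq ?_
      rw [lintegral_indicator_one Metric.isClosed_closedBall.measurableSet,
        Measure.addHaar_closedBall _ _ hΔ, finrank_euclideanSpace, Fintype.card_fin]
  set V := volume.real (region S) with hV
  have hvol : volume (region S) = ENNReal.ofReal V := by
    rw [hV, measureReal_def, ENNReal.ofReal_toReal (isCompact_region S).measure_lt_top.ne]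
  calc ∑ p ∈ S ×ˢ S, ‖pairWeight S K Δ θ p‖ₑ
      ≤ ∑ t ∈ S, ∑ s ∈ S, volume (cell S t) * volume (cell S s) *
          (ENNReal.ofReal (2 ^ d / V) * (Metric.closedBall t (ρ * Δ)).indicator 1 s) := by
        rw [Finset.sum_product]
        exact Finset.sum_le_sum fun t _ => Finset.sum_le_sum fun s _ =>
          hw.enorm_pairWeight_le θ (t, s)
    _ = ∑ t ∈ S, volume (cell S t) * (ENNReal.ofReal (2 ^ d / V) *
          ∑ s ∈ S, volume (cell S s) * (Metric.closedBall t (ρ * Δ)).indicator 1 s) := by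
        refine Finset.sum_congr rfl fun t _ => ?_
        rw [Finset.mul_sum, Finset.mul_sum]
        exact Finset.sum_congr rfl fun s _ => by ring
    _ ≤ ∑ t ∈ S, volume (cell S t) * (ENNReal.ofReal (2 ^ d / V) *
          (ENNReal.ofReal (((ρ + 1) * Δ) ^ d) *
            volume (Metric.ball (0 : EuclideanSpace ℝ (Fin d)) 1))) := by
        gcongr with t ht
        exact hball t
    _ = _ := by
        rw [← Finset.sum_mul, sum_volume_cell, hvol, ← mul_assoc,
          ← ENNReal.ofReal_mul hw.volume_pos.le, mul_div_cancel₀ _ hw.volume_pos.ne']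

/-- Here the localization of the weight is discarded and only its maximum is kept, so the double sum
factors; decay comes from `f` and `g`. -/
theorem AdmissibleWindow.sum_pairWeight_mul_le (hw : AdmissibleWindow (region S) K L ρ Δ R)
    (θ : EuclideanSpace ℝ (Fin d)) (f g : EuclideanSpace ℝ (Fin d) → ℝ≥0∞) {A : ℝ≥0∞}
    (hf : ∑ t ∈ S, volume (cell S t) * f t ≤ A) (hg : ∑ s ∈ S, volume (cell S s) * g s ≤ A) :
    ∑ q ∈ S ×ˢ S, ‖pairWeight S K Δ θ q‖ₑ * (f q.1 * g q.2) ≤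
      ENNReal.ofReal (2 ^ d / volume.real (region S)) * A ^ 2 := by
  calc ∑ q ∈ S ×ˢ S, ‖pairWeight S K Δ θ q‖ₑ * (f q.1 * g q.2)
      ≤ ∑ t ∈ S, ∑ s ∈ S, ENNReal.ofReal (2 ^ d / volume.real (region S)) *
          ((volume (cell S t) * f t) * (volume (cell S s) * g s)) := by
        rw [Finset.sum_product]
        refine Finset.sum_le_sum fun t _ => Finset.sum_le_sum fun s _ => ?_
        have h1 : (Metric.closedBall t (ρ * Δ)).indicator
            (1 : EuclideanSpace ℝ (Fin d) → ℝ≥0∞) s ≤ 1 :=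
          Set.indicator_le_self' (fun _ _ => bot_le) s
        calc ‖pairWeight S K Δ θ (t, s)‖ₑ * (f t * g s)
            ≤ (volume (cell S t) * volume (cell S s) *
                (ENNReal.ofReal (2 ^ d / volume.real (region S)) * 1)) * (f t * g s) := by
              gcongr
              exact (hw.enorm_pairWeight_le θ (t, s)).trans (by gcongr)
          _ = _ := by ring
    _ = ENNReal.ofReal (2 ^ d / volume.real (region S)) *
          ((∑ t ∈ S, volume (cell S t) * f t) * ∑ s ∈ S, volume (cell S s) * g s) := by
        rw [Finset.sum_mul_sum]
        simp_rw [Finset.mul_sum]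
    _ ≤ _ := by
        rw [sq]
        gcongr

variable [TopologicalSpace.SeparableSpace H] [MeasurableSpace H] [BorelSpace H]
  {Ω : Type*} [MeasurableSpace Ω] {P : Measure Ω} {X : EuclideanSpace ℝ (Fin d) → Ω → H}

/-- For a fixed pair $p$, the sum over $q$ of the covariance products is of order $1/|T|$; summing
the remaining weight over $p$ contributes order $\Delta^d$. -/
theorem IsStationaryGaussian.variance_le (hX : IsStationaryGaussian P b X)
    (hw : AdmissibleWindow (region S) K L ρ Δ R) (hρ : 0 ≤ ρ) (hmesh : meshSize S ≤ Δ)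
    (θ : EuclideanSpace ℝ (Fin d)) :
    ∫⁻ ω, hsNorm b (∑ p ∈ S ×ˢ S, pairWeight S K Δ θ p •
        (InnerProductSpace.rankOne ℂ (X p.1 ω) (X p.2 ω) - autocov P X (p.1 - p.2))) ^ 2 ∂P ≤
      2 * volume (Metric.ball (0 : EuclideanSpace ℝ (Fin d)) 1) *
        covarianceMass b (autocov P X) (meshSize S) ^ 2 *
        ENNReal.ofReal (4 ^ d * (ρ + 1) ^ d * (Δ ^ d / volume.real (region S))) := by
  set C := autocov P X
  set A := covarianceMass b C (meshSize S)
  set W := ENNReal.ofReal (2 ^ d / volume.real (region S)) with hW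
  have hhs : ∀ T : H →L[ℂ] H, hsNorm b T ≤ crossNorm b T := fun T => le_self_add
  have hdiag : ∀ T : H →L[ℂ] H, diagNorm b T ≤ crossNorm b T := fun T => le_add_self
  have hinner : ∀ p ∈ S ×ˢ S, ∑ q ∈ S ×ˢ S, ‖pairWeight S K Δ θ p‖ₑ * ‖pairWeight S K Δ θ q‖ₑ *
      (diagNorm b (C (p.1 - q.1)) * diagNorm b (C (p.2 - q.2)) +
        hsNorm b (C (p.1 - q.2)) * hsNorm b (C (p.2 - q.1))) ≤
      ‖pairWeight S K Δ θ p‖ₑ * (2 * (W * A ^ 2)) := by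
    intro p _
    have h1 := hw.sum_pairWeight_mul_le θ (fun t => crossNorm b (C (p.1 - t)))
      (fun s => crossNorm b (C (p.2 - s))) (sum_cell_crossNorm_sub_left_le b C S p.1)
      (sum_cell_crossNorm_sub_left_le b C S p.2)
    have h2 := hw.sum_pairWeight_mul_le θ (fun t => crossNorm b (C (p.2 - t)))
      (fun s => crossNorm b (C (p.1 - s))) (sum_cell_crossNorm_sub_left_le b C S p.2)
      (sum_cell_crossNorm_sub_left_le b C S p.1)
    calc _ ≤ ∑ q ∈ S ×ˢ S, ‖pairWeight S K Δ θ p‖ₑ *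
          (‖pairWeight S K Δ θ q‖ₑ * (crossNorm b (C (p.1 - q.1)) * crossNorm b (C (p.2 - q.2))) +
          ‖pairWeight S K Δ θ q‖ₑ * (crossNorm b (C (p.2 - q.1)) * crossNorm b (C (p.1 - q.2)))) := by
          refine Finset.sum_le_sum fun q _ => ?_
          rw [mul_assoc, ← mul_add, mul_comm (hsNorm b (C (p.1 - q.2)))]
          gcongr
          · exact hdiag _
          · exact hdiag _
          · exact hhs _
          · exact hhs _
      _ ≤ _ := by
          rw [← Finset.mul_sum, Finset.sum_add_distrib, two_mul]
          gcongr
  refine (hX.lintegral_hsNorm_sq_le (S ×ˢ S) Prod.fst Prod.snd (pairWeight S K Δ θ)).trans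
    ((Finset.sum_le_sum hinner).trans ?_)
  rw [← Finset.sum_mul]
  refine (mul_le_mul_left (hw.sum_enorm_pairWeight_le hρ hmesh θ) _).trans_eq ?_
  have h4 : (4 : ℝ) ^ d * (ρ + 1) ^ d * (Δ ^ d / volume.real (region S)) =
      2 ^ d * (((ρ + 1) * Δ) ^ d * (2 ^ d / volume.real (region S))) := by
    have : (4 : ℝ) ^ d = 2 ^ d * 2 ^ d := by rw [← mul_pow]; norm_num
    rw [this, mul_pow]
    ring
  have hΔ : 0 ≤ (ρ + 1) * Δ := mul_nonneg (by linarith) (by linarith [hw.one_le_bandwidth])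
  rw [h4, ENNReal.ofReal_mul (by positivity), ENNReal.ofReal_mul (by positivity)]
  ring

end Variance

/-! ### Compatibility with the projection -/

section Projection

variable {d : ℕ} {H : Type*} [NormedAddCommGroup H] [InnerProductSpace ℂ H] [CompleteSpace H]

/-- The compression `T ↦ Q T Q` as a continuous linear map. -/
noncomputable def compressCLM (Q : H →L[ℂ] H) : (H →L[ℂ] H) →L[ℂ] (H →L[ℂ] H) :=
  (ContinuousLinearMap.compL ℂ H H H Q) ∘L (ContinuousLinearMap.compL ℂ H H H).flip Q

theorem compressCLM_apply (Q T : H →L[ℂ] H) : compressCLM Q T = compress Q T := rfl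

variable {ι : Type*} {b : HilbertBasis ι ℂ H} {γ : ℝ}
  [TopologicalSpace.SeparableSpace H] [MeasurableSpace H] [BorelSpace H]
  {Ω : Type*} [MeasurableSpace Ω] {P : Measure Ω} {X : EuclideanSpace ℝ (Fin d) → Ω → H}

/-- Self-adjointness gives $Qx\otimes Qy=Q(x\otimes y)Q$, and compression, being continuous and
linear, passes through the expectation. -/
theorem IsStationaryGaussian.autocov_compress (hX : IsStationaryGaussian P b X)
    {Q : H →L[ℂ] H} (hQ : IsSelfAdjoint Q) (h : EuclideanSpace ℝ (Fin d)) :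
    autocov P (fun t ω => Q (X t ω)) h = compress Q (autocov P X h) := by
  rw [autocov, autocov, covOp, covOp, ← compressCLM_apply,
    ← ContinuousLinearMap.integral_comp_comm _ (hX.integrable_rankOne h 0)]
  refine integral_congr_ae (ae_of_all _ fun ω => ?_)
  ext x
  have h1 : inner ℂ (Q (X 0 ω)) x = inner ℂ (X 0 ω) (Q x) := by
    rw [← ContinuousLinearMap.adjoint_inner_right, ← ContinuousLinearMap.star_eq_adjoint, hQ.star_eq]
  simp [compressCLM_apply, compress, h1]

theorem IsStationaryGaussian.spectralDensity_compress (hX : IsStationaryGaussian P b X)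
    (hC : CovarianceRegular b (autocov P X) γ) {Q : H →L[ℂ] H} (hQ : IsSelfAdjoint Q)
    (θ : EuclideanSpace ℝ (Fin d)) :
    spectralDensity (autocov P fun t ω => Q (X t ω)) θ =
      compress Q (spectralDensity (autocov P X) θ) := by
  have hint : Integrable (fun h => character θ h • autocov P X h) :=
    hC.integrable_covariance.bdd_smul 1 (continuous_character θ).aestronglyMeasurable
      (ae_of_all _ fun h => (norm_character θ h).le)
  rw [spectralDensity, spectralDensity, ← compressCLM_apply, map_smul,
    ← ContinuousLinearMap.integral_comp_comm _ hint]
  simp_rw [map_smul, compressCLM_apply, hX.autocov_compress hQ]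

end Projection

/-! ### Combining variance and bias -/

section Estimator

variable {d : ℕ} {H : Type*} [NormedAddCommGroup H] [InnerProductSpace ℂ H] [CompleteSpace H]
  {ι : Type*} {b : HilbertBasis ι ℂ H} {γ : ℝ}
  {Ω : Type*} [MeasurableSpace Ω] {P : Measure Ω} {X : EuclideanSpace ℝ (Fin d) → Ω → H}
  {K : EuclideanSpace ℝ (Fin d) → ℝ} {L : ℝ≥0} {ρ Δ R : ℝ}
  {S : Finset (EuclideanSpace ℝ (Fin d))}

/-- The expectation of the lag-window estimator, up to the factor `(2π)⁻ᵈ`. -/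
noncomputable def meanSum (C : EuclideanSpace ℝ (Fin d) → H →L[ℂ] H)
    (S : Finset (EuclideanSpace ℝ (Fin d))) (K : EuclideanSpace ℝ (Fin d) → ℝ) (Δ : ℝ)
    (θ : EuclideanSpace ℝ (Fin d)) : H →L[ℂ] H :=
  ∑ t ∈ S, ∑ s ∈ S, (volume.real (cell S t) * volume.real (cell S s)) •
    lagWeight (region S) K Δ θ (t - s) • C (t - s)

theorem estimator_sub_spectralDensity (X : EuclideanSpace ℝ (Fin d) → Ω → H)
    (C : EuclideanSpace ℝ (Fin d) → H →L[ℂ] H)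
    (S : Finset (EuclideanSpace ℝ (Fin d))) (K : EuclideanSpace ℝ (Fin d) → ℝ) (Δ : ℝ)
    (θ : EuclideanSpace ℝ (Fin d)) (ω : Ω) :
    estimator X S K Δ θ ω - spectralDensity C θ = (((2 * Real.pi) ^ d)⁻¹ : ℂ) •
      ((∑ p ∈ S ×ˢ S, pairWeight S K Δ θ p •
        (InnerProductSpace.rankOne ℂ (X p.1 ω) (X p.2 ω) - C (p.1 - p.2))) +
        (meanSum C S K Δ θ - ∫ h, character θ h • C h)) := by
  have h1 : meanSum C S K Δ θ = ∑ p ∈ S ×ˢ S, pairWeight S K Δ θ p • C (p.1 - p.2) := by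
    rw [meanSum, Finset.sum_product]
    refine Finset.sum_congr rfl fun t _ => Finset.sum_congr rfl fun s _ => ?_
    rw [pairWeight, ← Complex.coe_smul, smul_smul]
  rw [estimator, spectralDensity, ← smul_sub, h1, ← add_sub_assoc, ← Finset.sum_add_distrib,
    Finset.sum_product]
  congr 2
  refine Finset.sum_congr rfl fun t _ => Finset.sum_congr rfl fun s _ => ?_
  rw [← smul_add, sub_add_cancel, pairWeight, lagWeight, overlap]
  congr 1
  push_cast
  ring

theorem enorm_normalization_le (d : ℕ) : ‖(((2 * Real.pi) ^ d)⁻¹ : ℂ)‖ₑ ≤ 1 := by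
  rw [← ofReal_norm]
  refine ENNReal.ofReal_le_one.2 ?_
  rw [norm_inv, norm_pow, norm_mul, Complex.norm_real, Real.norm_of_nonneg Real.pi_pos.le]
  refine inv_le_one_of_one_le₀ (one_le_pow₀ ?_)
  norm_num
  linarith [Real.pi_gt_three]

/-- Contraction under `Q`, then $(a+b)^2\le2a^2+2b^2$ for the random and the deterministic part.
Here `x` stands for the variance rate and `y` for the bias rate. -/
theorem rootMeanSquare_compress_le [IsProbabilityMeasure P] {Q : H →L[ℂ] H} (hQ : ‖Q‖ ≤ 1)
    (C : EuclideanSpace ℝ (Fin d) → H →L[ℂ] H) (θ : EuclideanSpace ℝ (Fin d))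
    {x y v β : ℝ} (hx : 0 ≤ x) (hy : 0 ≤ y) (hv : 0 ≤ v) (hβ : 0 ≤ β)
    (hvar : ∫⁻ ω, hsNorm b (∑ p ∈ S ×ˢ S, pairWeight S K Δ θ p •
        (InnerProductSpace.rankOne ℂ (X p.1 ω) (X p.2 ω) - C (p.1 - p.2))) ^ 2 ∂P ≤
      ENNReal.ofReal ((v * x) ^ 2))
    (hbias : hsNorm b (meanSum C S K Δ θ - ∫ h, character θ h • C h) ≤ ENNReal.ofReal (β * y)) :
    rootMeanSquare P b (fun ω => compress Q (estimator X S K Δ θ ω) -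
      compress Q (spectralDensity C θ)) ≤ ENNReal.ofReal (2 * (v + β) * (y + x)) := by
  have hle : ∫⁻ ω, hsNorm b (compress Q (estimator X S K Δ θ ω) -
      compress Q (spectralDensity C θ)) ^ 2 ∂P ≤ ENNReal.ofReal (2 * (v + β) * (y + x)) ^ 2 := by
    calc ∫⁻ ω, hsNorm b (compress Q (estimator X S K Δ θ ω) -
          compress Q (spectralDensity C θ)) ^ 2 ∂P
        ≤ ∫⁻ ω, (2 * hsNorm b (∑ p ∈ S ×ˢ S, pairWeight S K Δ θ p •
            (InnerProductSpace.rankOne ℂ (X p.1 ω) (X p.2 ω) - C (p.1 - p.2))) ^ 2 +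
            2 * ENNReal.ofReal (β * y) ^ 2) ∂P := by
          refine lintegral_mono fun ω => ?_
          have h1 : hsNorm b (compress Q (estimator X S K Δ θ ω) -
              compress Q (spectralDensity C θ)) ≤
              hsNorm b (∑ p ∈ S ×ˢ S, pairWeight S K Δ θ p •
                (InnerProductSpace.rankOne ℂ (X p.1 ω) (X p.2 ω) - C (p.1 - p.2))) +
              ENNReal.ofReal (β * y) := by
            rw [← compressCLM_apply, ← compressCLM_apply, ← map_sub, compressCLM_apply]
            refine (hsNorm_compress_le b hQ _).trans ?_
            rw [estimator_sub_spectralDensity, hsNorm_smul]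
            refine (mul_le_of_le_one_left' (enorm_normalization_le d)).trans ?_
            exact (hsNorm_add_le b _ _).trans (by gcongr)
          refine (pow_le_pow_left' h1 2).trans ?_
          have h2 := ENNReal.rpow_add_le_mul_rpow_add_rpow
            (hsNorm b (∑ p ∈ S ×ˢ S, pairWeight S K Δ θ p •
              (InnerProductSpace.rankOne ℂ (X p.1 ω) (X p.2 ω) - C (p.1 - p.2))))
            (ENNReal.ofReal (β * y)) (p := 2) (by norm_num)
          norm_num at h2
          rw [← mul_add]
          exact h2
      _ ≤ 2 * ENNReal.ofReal ((v * x) ^ 2) + 2 * ENNReal.ofReal (β * y) ^ 2 := by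
          -- The bias term is constant in $\omega$, so the integral splits without measurability of
          -- the random Hilbert–Schmidt norm.
          rw [lintegral_add_right _ measurable_const, lintegral_const_mul' _ _ (by simp),
            lintegral_const, measure_univ, mul_one]
          gcongr
      _ = ENNReal.ofReal (2 * (v * x) ^ 2 + 2 * (β * y) ^ 2) := by
          rw [ENNReal.ofReal_add (by positivity) (by positivity),
            ENNReal.ofReal_mul (p := 2) (q := (v * x) ^ 2) (by norm_num),
            ENNReal.ofReal_mul (p := 2) (q := (β * y) ^ 2) (by norm_num),
            ENNReal.ofReal_pow (p := β * y) (by positivity), ENNReal.ofReal_ofNat]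
      _ ≤ ENNReal.ofReal ((2 * (v + β) * (y + x)) ^ 2) := by
          refine ENNReal.ofReal_le_ofReal ?_
          have h1 : v * x ≤ (v + β) * (y + x) := by
            nlinarith [mul_nonneg hv hy, mul_nonneg hβ hx, mul_nonneg hβ hy]
          have h2 : β * y ≤ (v + β) * (y + x) := by
            nlinarith [mul_nonneg hv hy, mul_nonneg hβ hx, mul_nonneg hv hx]
          nlinarith [pow_le_pow_left₀ (mul_nonneg hv hx) h1 2,
            pow_le_pow_left₀ (mul_nonneg hβ hy) h2 2]
      _ = _ := ENNReal.ofReal_pow (by positivity) 2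
  rw [rootMeanSquare]
  refine (ENNReal.rpow_le_rpow hle (by norm_num)).trans_eq ?_
  rw [← ENNReal.rpow_natCast, ← ENNReal.rpow_mul]
  norm_num

end Estimator

/-! ### The window eventually fits into the region -/

section Asymptotics

variable {d : ℕ} {K : EuclideanSpace ℝ (Fin d) → ℝ} {S : ℕ → Finset (EuclideanSpace ℝ (Fin d))}
  {Δ : ℕ → ℝ}

theorem KernelRegular.exists_support_bound (hK : KernelRegular K) :
    ∃ ρ : ℝ, 0 < ρ ∧ ∀ u, K u ≠ 0 → ‖u‖ ≤ ρ := by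
  obtain ⟨ρ, hρ, h⟩ := hK.bounded_support.exists_pos_norm_le
  exact ⟨ρ, hρ, fun u hu => h u ((hK.nonneg u).lt_of_ne' hu)⟩

/-- Eventually the bandwidth is small compared with the inradius of the sampling region. -/
theorem SamplingDesign.eventually_admissibleWindow (hS : SamplingDesign S) (hK : KernelRegular K)
    (hΔ : Tendsto Δ atTop atTop)
    (hΔvol : Tendsto (fun n => Δ n ^ d / volume.real (region (S n))) atTop (𝓝 0)) :
    ∃ (L : ℝ≥0) (ρ : ℝ) (R : ℕ → ℝ), 0 ≤ ρ ∧
      ∀ᶠ n in atTop, AdmissibleWindow (region (S n)) K L ρ (Δ n) (R n) := by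
  obtain ⟨L, hL⟩ := hK.lipschitz
  obtain ⟨ρ, hρ, hsupp⟩ := hK.exists_support_bound
  obtain ⟨r, hr, hball⟩ := hS.exists_closedBall_subset
  have hd := hS.dim_pos
  have hd' : (0 : ℝ) < d := by exact_mod_cast hd
  have hlim : Tendsto (fun n => r * volume.real (region (S n)) ^ (1 / d : ℝ)) atTop atTop :=
    ((tendsto_rpow_atTop (by positivity : (0 : ℝ) < 1 / d)).comp hS.volume_tendsto).const_mul_atTop hr
  -- This threshold for $\Delta_n^d/|T_n|$ turns, after taking $d$-th roots, into $\rho\Delta_n\le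
  -- R_n/4$.
  have hc : 0 < (r / (4 * ρ)) ^ d := by positivity
  refine ⟨L, ρ, fun n => r * volume.real (region (S n)) ^ (1 / d : ℝ), hρ.le, ?_⟩
  filter_upwards [hball, hlim.eventually_ge_atTop 1, hΔ.eventually_ge_atTop 1,
    hS.volume_tendsto.eventually_gt_atTop 0, hΔvol.eventually_lt_const hc] with n h1 h2 h3 h4 h5
  refine ⟨convex_region _, isCompact_region _, h1, h4, h2, h3, ?_, hsupp, hL, hK.nonneg, hK.le_one⟩
  set V := volume.real (region (S n))
  have h6 : Δ n ^ d ≤ (r / (4 * ρ) * V ^ (1 / d : ℝ)) ^ d := by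
    rw [mul_pow, ← Real.rpow_natCast (V ^ (1 / d : ℝ)), ← Real.rpow_mul h4.le,
      one_div_mul_cancel hd'.ne', Real.rpow_one]
    exact ((div_lt_iff₀ h4).1 h5).le
  have h7 : Δ n ≤ r / (4 * ρ) * V ^ (1 / d : ℝ) :=
    (pow_le_pow_iff_left₀ (by linarith) (by positivity) hd.ne').1 h6
  calc ρ * Δ n ≤ ρ * (r / (4 * ρ) * V ^ (1 / d : ℝ)) := by gcongr
    _ = r * V ^ (1 / d : ℝ) / 4 := by field_simp

end Asymptotics

end SpectralRKHS

/-! ### The main theorem -/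

open SpectralRKHS
theorem mainTheorem10
    {d : ℕ}
    {E : Type*} [TopologicalSpace E] [CompactSpace E]
    {H : Type*} [NormedAddCommGroup H] [InnerProductSpace ℂ H] [CompleteSpace H]
    [TopologicalSpace.SeparableSpace H] [MeasurableSpace H] [BorelSpace H]
    [RKHS ℂ H E ℂ]
    (hR : Continuous fun p : E × E => reproducingKernel H p.1 p.2)
    {ι : Type*} (b : HilbertBasis ι ℂ H)
    {Ω : Type*} [MeasurableSpace Ω] (P : Measure Ω) [IsProbabilityMeasure P]
    (X : EuclideanSpace ℝ (Fin d) → Ω → H) (hX : IsStationaryGaussian P b X)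
    (γ : ℝ) (hC : CovarianceRegular b (autocov P X) γ)
    (K : EuclideanSpace ℝ (Fin d) → ℝ) (hK : KernelRegular K)
    (S : ℕ → Finset (EuclideanSpace ℝ (Fin d))) (hS : SamplingDesign S)
    (m : ℕ → ℕ) (u : ∀ n, Fin (m n) → E)
    (hu : ∀ n, IsUnit (kernelMatrix H (u n)))
    (Δ : ℕ → ℝ) (hΔ : Tendsto Δ atTop atTop)
    (hΔS : ∀ᶠ n in atTop, Δ n • kernelSupport K ⊆ region (S n) - region (S n))
    (hΔvol : Tendsto (fun n => Δ n ^ d / volume.real (region (S n))) atTop (𝓝 0)) :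
    (∀ n θ, spectralDensity (autocov P fun t ω => observationProjection H (u n) (X t ω)) θ =
      compress (observationProjection H (u n)) (spectralDensity (autocov P X) θ)) ∧
    ∀ Θ : Set (EuclideanSpace ℝ (Fin d)), Bornology.IsBounded Θ →
      ∃ c : ℝ, ∀ᶠ n in atTop, ∀ θ ∈ Θ,
        rootMeanSquare P b (fun ω =>
          compress (observationProjection H (u n)) (estimator X (S n) K (Δ n) θ ω) -
            spectralDensity (autocov P fun t ω' => observationProjection H (u n) (X t ω')) θ) ≤
        ENNReal.ofReal (c * (meshSize (S n) ^ γ +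
          biasB1 b (autocov P X) K (Δ n) θ + biasB2 b (autocov P X) K (Δ n) θ +
          √(Δ n ^ d / volume.real (region (S n))))) := by
  have hproj : ∀ n, IsSelfAdjoint (observationProjection H (u n)) := fun n =>
    isSelfAdjoint_starProjection _
  have hdens := fun n θ => hX.spectralDensity_compress hC (hproj n) θ
  refine ⟨hdens, fun Θ hΘ => ?_⟩
  obtain ⟨L, ρ, R, hρ, hwin⟩ := hS.eventually_admissibleWindow hK hΔ hΔvol
  obtain ⟨hγ, hγ1, M, δ₀, hδ₀, hM⟩ := hC.holder
  obtain ⟨B, hB0, hB⟩ := hΘ.exists_pos_norm_le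
  have : Nonempty (Fin d) := ⟨⟨0, hS.dim_pos⟩⟩
  set C := autocov P X with hCdef
  set τ := (∫⁻ h, traceNorm b (C h)).toReal
  have hτ' : ∫⁻ h, traceNorm b (C h) = ENNReal.ofReal τ :=
    (ENNReal.ofReal_toReal hC.integrable.ne).symm
  have hτ0 : 0 ≤ τ := ENNReal.toReal_nonneg
  set vol1 := volume.real (Metric.ball (0 : EuclideanSpace ℝ (Fin d)) 1) with hvol1
  have hvol1' : volume (Metric.ball (0 : EuclideanSpace ℝ (Fin d)) 1) = ENNReal.ofReal vol1 :=
    (ENNReal.ofReal_toReal measure_ball_lt_top.ne).symm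
  -- Bounds `covarianceMass` at every mesh below $\delta_0$; the absolute value is there because the
  -- sign of $M$ is not prescribed.
  set A := 2 * (τ + |M| * δ₀ ^ γ) with hA
  have hA0 : 0 ≤ A := by positivity
  set D := 2 ^ d * B + 2 ^ d * L + 4 ^ d * d with hD
  have hD0 : 0 ≤ D := by positivity
  -- The three terms account for the oscillation at scale $2\delta$ (with $2^\gamma\le2$), the
  -- Lipschitz error of the weight, and the coefficient $1$ of $B_1+B_2$. The frequency enters only
  -- through $\|\theta\|\le B$ in `D`, hence the uniformity over $\Theta$.
  set β := 2 ^ d * (|M| * 2) + 2 * D * τ + 1 with hβ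
  set v := √(2 * vol1 * A ^ 2 * (4 ^ d * (ρ + 1) ^ d)) with hv
  refine ⟨2 * (v + β), ?_⟩
  -- The bound $1/8$ ensures $2\delta\le R/4$, as $R\ge1$; the bound $\delta_0/2$ allows the Hölder
  -- condition at scale $2\delta$.
  filter_upwards [hwin, hS.mesh.eventually_le_const (by positivity : 0 < min (1 / 8) (δ₀ / 2)),
    hΔ.eventually_ge_atTop 1] with n hw hmesh hΔ1 θ hθ
  have hδpos : 0 < meshSize (S n) := meshSize_pos hw.volume_pos
  set δ := meshSize (S n) with hδ
  have hδ8 : δ ≤ 1 / 8 := hmesh.trans (min_le_left _ _)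
  have hδδ₀ : δ ≤ δ₀ / 2 := hmesh.trans (min_le_right _ _)
  have hosc := hM (2 * δ) (by linarith) (by linarith)
  have hosc1 := hM δ hδpos (by linarith)
  set V := volume.real (region (S n)) with hV
  have hV0 : 0 < V := hw.volume_pos
  have hB1 : 0 ≤ biasB1 b C K (Δ n) θ := ENNReal.toReal_nonneg
  have hB2 : 0 ≤ biasB2 b C K (Δ n) θ := ENNReal.toReal_nonneg
  have hδγ : 0 ≤ δ ^ γ := by positivity
  have hratio : 0 ≤ Δ n ^ d / V := by positivity
  rw [hdens]
  refine rootMeanSquare_compress_le ?_ C θ (Real.sqrt_nonneg _) (by positivity)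
    (Real.sqrt_nonneg _) (by positivity) ?_ ?_
  · exact Submodule.starProjection_norm_le _
  · refine (hX.variance_le hw hρ (by linarith) θ).trans ?_
    have hmass : covarianceMass b C δ ≤ ENNReal.ofReal A := by
      rw [covarianceMass, lintegral_const_mul' _ _ (by simp), lintegral_add_right' _ hosc1.1, hτ', hA,
        ENNReal.ofReal_mul (by norm_num), ENNReal.ofReal_ofNat, ENNReal.ofReal_add hτ0 (by positivity)]
      gcongr
      refine hosc1.2.trans (ENNReal.ofReal_le_ofReal ?_)
      gcongr
      · exact le_abs_self M
      · linarith
    rw [mul_pow, hv, Real.sq_sqrt (by positivity), Real.sq_sqrt hratio, hvol1']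
    calc _ ≤ 2 * ENNReal.ofReal vol1 * ENNReal.ofReal A ^ 2 *
          ENNReal.ofReal (4 ^ d * (ρ + 1) ^ d * (Δ n ^ d / V)) := by gcongr
      _ = ENNReal.ofReal (2 * vol1 * A ^ 2 * (4 ^ d * (ρ + 1) ^ d) * (Δ n ^ d / V)) := by
          rw [mul_assoc (2 * vol1 * A ^ 2), ENNReal.ofReal_mul (p := 2 * vol1 * A ^ 2) (by positivity),
            ENNReal.ofReal_mul (p := 2 * vol1) (by positivity),
            ENNReal.ofReal_mul (p := 2) (q := vol1) (by positivity),
            ENNReal.ofReal_pow hA0, ENNReal.ofReal_ofNat]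
  · have h1 := hw.hsNorm_discretization_le hC (by linarith [hw.one_le_radius]) hosc.1 θ
    have h2 := hK.hsNorm_smoothing_le hC (by linarith : 0 < Δ n) θ
    have h3 : meanSum C (S n) K (Δ n) θ - ∫ h, character θ h • C h =
        (meanSum C (S n) K (Δ n) θ - ∫ h, (character θ h * (K ((Δ n)⁻¹ • h) : ℂ)) • C h) +
        ((∫ h, (character θ h * (K ((Δ n)⁻¹ • h) : ℂ)) • C h) - ∫ h, character θ h • C h) := by
      abel
    rw [h3]
    refine (hsNorm_add_le b _ _).trans ((add_le_add h1 h2).trans ?_)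
    rw [hτ']
    have h4 : ENNReal.ofReal (2 ^ d) * (∫⁻ x, oscillation b C (2 * δ) x) ≤
        ENNReal.ofReal (2 ^ d * (|M| * 2) * δ ^ γ) := by
      rw [mul_assoc, ENNReal.ofReal_mul (by positivity)]
      gcongr
      refine hosc.2.trans (ENNReal.ofReal_le_ofReal ?_)
      rw [Real.mul_rpow (by norm_num) hδpos.le, ← mul_assoc]
      gcongr
      · exact le_abs_self M
      · calc (2 : ℝ) ^ γ ≤ 2 ^ (1 : ℝ) := Real.rpow_le_rpow_of_exponent_le (by norm_num) hγ1
          _ = 2 := Real.rpow_one 2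
    have h5 : ENNReal.ofReal (2 * δ * (2 ^ d * ‖θ‖ + 2 ^ d * L + 4 ^ d * d)) * ENNReal.ofReal τ ≤
        ENNReal.ofReal (2 * D * τ * δ ^ γ) := by
      rw [← ENNReal.ofReal_mul (by positivity)]
      refine ENNReal.ofReal_le_ofReal ?_
      -- The Lipschitz error of order $\delta$ is absorbed into $\delta^\gamma$, using $\gamma\le1$
      -- and $\delta\le1$.
      have h6 : δ ≤ δ ^ γ := by
        calc δ = δ ^ (1 : ℝ) := (Real.rpow_one δ).symm
          _ ≤ δ ^ γ := Real.rpow_le_rpow_of_exponent_ge hδpos (by linarith) hγ1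
      have h7 : 2 ^ d * ‖θ‖ + 2 ^ d * L + 4 ^ d * d ≤ D := by
        rw [hD]
        gcongr
        exact hB θ hθ
      calc 2 * δ * (2 ^ d * ‖θ‖ + 2 ^ d * L + 4 ^ d * d) * τ ≤ 2 * δ ^ γ * D * τ := by gcongr
        _ = 2 * D * τ * δ ^ γ := by ring
    refine (add_le_add (add_le_add h4 h5) le_rfl).trans ?_
    rw [← ENNReal.ofReal_add (by positivity) (by positivity),
      ← ENNReal.ofReal_add (by positivity) (by positivity)]
    refine ENNReal.ofReal_le_ofReal ?_
    have hβ1 : 1 ≤ β := by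
      rw [hβ]
      linarith [show 0 ≤ 2 ^ d * (|M| * 2) + 2 * D * τ by positivity]
    have h8 := mul_le_mul_of_nonneg_right hβ1 (add_nonneg hB1 hB2)
    calc _ ≤ β * δ ^ γ + (biasB1 b C K (Δ n) θ + biasB2 b C K (Δ n) θ) := by
          rw [hβ]
          nlinarith
      _ ≤ _ := by linarith
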